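/- Let $U\subset\mathbb{C}^n$ be an open neighbourhood of $0$ (for instance $U=\mathbb{C}^n$) and let $F:U\to\mathbb{C}^n$ be a holomorphic map with $F(0)=0$ whose derivative $L=F'(0)$ is invertible and contracting, i.e. all eigenvalues of $L$ are non-zero and of modulus $<1$. Let $\lambda_1,\dots,\lambda_l$ be the distinct eigenvalues of $L$ and $E_{\lambda_1},\dots,E_{\lambda_l}$ its generalized eigenspaces, so that $\mathbb{C}^n=E_{\lambda_1}\oplus\cdots\oplus E_{\lambda_l}$. A homogeneous polynomial map $Q:\mathbb{C}^n\to\mathbb{C}^n$ with $Q(0)=0$ is said to be of type $s=(s_1,\dots,s_l)\in\mathbb{N}^l$ if \[ Q(a_1t_1+\cdots+a_lt_l)=a_1^{s_1}\cdots a_l^{s_l}\,Q(t_1+\cdots+t_l) \] for all $a_1,\dots,a_l\in\mathbb{C}$ and all $(t_1,\dots,t_l)\in E_{\lambda_1}\times\cdots\times E_{\lambda_l}$. A polynomial map $P:\mathbb{C}^n\to\mathbb{C}^n$ with $P(0)=0$ is sub-resonant with respect to $L$ if, for each $i$, its component $P_i:\mathbb{C}^n\to E_{\lambda_i}$ is a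 finite sum of homogeneous polynomial maps $\mathbb{C}^n\to E_{\lambda_i}$ of types $s$ satisfying $\ln|\lambda_i|\le\sum_j s_j\ln|\lambda_j|$. Let $SR^*(L)$ be the set of sub-resonant polynomial maps whose derivative at $0$ is invertible. Then there exist $P\in SR^*(L)$ with $P'(0)=L$ and a biholomorphism $\phi$ between two open neighbourhoods of $0$ in $\mathbb{C}^n$, with $\phi(0)=0$ and $\phi'(0)=\mathrm{Id}$, such that $\phi^{-1}\circ F\circ\phi=P$ on a neighbourhood of $0$. -/

import Mathlib

open scoped Topology

noncomputable section

namespace SubResonance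

variable {n : ℕ}

/-- A polynomial map `ℂⁿ → ℂⁿ`: every coordinate is given by a polynomial. -/
def IsPolynomialMap (P : (Fin n → ℂ) → (Fin n → ℂ)) : Prop :=
  ∃ p : Fin n → MvPolynomial (Fin n) ℂ, ∀ x i, P x i = MvPolynomial.eval x (p i)

/-- A homogeneous polynomial map `ℂⁿ → ℂⁿ` of degree `d`. -/
def IsHomogeneousPolynomialMap (d : ℕ) (Q : (Fin n → ℂ) → (Fin n → ℂ)) : Prop :=
  ∃ q : Fin n → MvPolynomial (Fin n) ℂ,
    (∀ i, (q i).IsHomogeneous d) ∧ ∀ x i, Q x i = MvPolynomial.eval x (q i)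

/-- `Q` is a homogeneous polynomial map fixing `0`, of type `s` with respect to the decomposition
of `ℂⁿ` into the generalized eigenspaces of `L`. Types are indexed by the distinct eigenvalues. -/
structure IsHomogeneousOfType (L : Module.End ℂ (Fin n → ℂ)) (s : L.Eigenvalues → ℕ)
    (Q : (Fin n → ℂ) → (Fin n → ℂ)) : Prop where
  homogeneous : ∃ d, IsHomogeneousPolynomialMap d Q
  map_zero : Q 0 = 0
  scaling : ∀ (a : L.Eigenvalues → ℂ) (t : L.Eigenvalues → (Fin n → ℂ)),
    (∀ μ : L.Eigenvalues, t μ ∈ L.maxGenEigenspace (μ : ℂ)) →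
      Q (∑ μ, a μ • t μ) = (∏ μ, a μ ^ s μ) • Q (∑ μ, t μ)

/-- The sub-resonance relation for a term of type `s` with values in the generalized eigenspace
of the eigenvalue `μ`. -/
def SubResonanceRelation (L : Module.End ℂ (Fin n → ℂ)) (μ : L.Eigenvalues)
    (s : L.Eigenvalues → ℕ) : Prop :=
  Real.log ‖(μ : ℂ)‖ ≤ ∑ ν : L.Eigenvalues, (s ν : ℝ) * Real.log ‖(ν : ℂ)‖

/-- `R` is a map into the generalized eigenspace of `μ` which is a finite sum of homogeneous
terms whose types satisfy the sub-resonance relation. -/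
def IsSubResonantComponent (L : Module.End ℂ (Fin n → ℂ)) (μ : L.Eigenvalues)
    (R : (Fin n → ℂ) → (Fin n → ℂ)) : Prop :=
  ∃ (T : Finset (L.Eigenvalues → ℕ)) (Q : (L.Eigenvalues → ℕ) → (Fin n → ℂ) → (Fin n → ℂ)),
    (∀ s ∈ T, SubResonanceRelation L μ s ∧ IsHomogeneousOfType L s (Q s) ∧
      ∀ x, Q s x ∈ L.maxGenEigenspace (μ : ℂ)) ∧
    ∀ x, R x = ∑ s ∈ T, Q s x

/-- Polynomial maps fixing `0` of sub-resonance type with respect to `L`: in the (unique)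
decomposition of `P` into components with values in the generalized eigenspaces of `L`, every
component consists of sub-resonant terms only. -/
def IsSubResonant (L : Module.End ℂ (Fin n → ℂ)) (P : (Fin n → ℂ) → (Fin n → ℂ)) : Prop :=
  IsPolynomialMap P ∧ P 0 = 0 ∧
    ∃ R : L.Eigenvalues → (Fin n → ℂ) → (Fin n → ℂ),
      (∀ μ, IsSubResonantComponent L μ (R μ)) ∧ ∀ x, P x = ∑ μ, R μ x

/-- `SR*(L)`: the sub-resonance type polynomial maps whose derivative at `0` is invertible. -/
def SRStar (L : Module.End ℂ (Fin n → ℂ)) : Set ((Fin n → ℂ) → (Fin n → ℂ)) :=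
  {P | IsSubResonant L P ∧ (fderiv ℂ P 0).IsInvertible}

/-- A linear map is contracting if all its eigenvalues have modulus less than one. -/
def IsContracting (L : Module.End ℂ (Fin n → ℂ)) : Prop :=
  ∀ μ : ℂ, L.HasEigenvalue μ → ‖μ‖ < 1

/-- A local biholomorphism of `ℂⁿ`: a homeomorphism between two open sets which is holomorphic
and has holomorphic inverse. -/
def IsLocalBiholomorphism (φ : OpenPartialHomeomorph (Fin n → ℂ) (Fin n → ℂ)) : Prop :=
  DifferentiableOn ℂ φ φ.source ∧ DifferentiableOn ℂ φ.symm φ.target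

end SubResonance

end

/-! The proof is Poincaré–Dulac normalisation followed by a contraction argument. Suppose `φ`
conjugates `F` to a sub-resonant `P` up to an error of order `d`, with leading term `M`, homogeneous
of degree `d`. Replacing `φ` by `φ + H` and `P` by `P + S` changes that leading term to `M + L ∘ H -
H ∘ L - S`. Split `M` by projecting its value and each of its arguments to generalized eigenspaces.
On a piece with `∏ |ν_j| < |μ|`, the operator `H ↦ L ∘ H - H ∘ L` is inverted by the convergent
series `∑ L⁻ᵏ⁻¹ ∘ M ∘ Lᵏ` (`exists_cohomological`). The remaining pieces are exactly the
sub-resonant ones and are put into `S`. Iteration gives a conjugacy to any finite order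
(`exists_jet_conjugacy`).

Once the order `K` satisfies `‖L⁻¹‖ ρ' ^ K < 1`, where `ρ' < 1` is a contraction rate of `P` near
`0`, `P` needs no further change. The equation `F ∘ (φ + g) = (φ + g) ∘ P` becomes a fixed point
problem for `g`, contracting on holomorphic maps of size `O(‖z‖ ^ K)` (`exists_correction`). Since
`g` vanishes to order at least two, `φ + g` is tangent to the identity, and the inverse function
theorem makes it a local biholomorphism.

Both stages rest on a few facts about holomorphic maps, all drawn from Cauchy and Schwarz estimates:
uniform limits and derivatives are holomorphic, and a germ vanishing to order `d` has a homogeneous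
leading term. -/

/-! ### Cauchy estimates, uniform limits and derivatives of holomorphic maps. -/

section Holomorphic

open Metric Set Filter Asymptotics

variable {E F : Type*} [NormedAddCommGroup E] [NormedSpace ℂ E]
  [NormedAddCommGroup F] [NormedSpace ℂ F]

theorem norm_fderiv_le_of_forall_mem_ball {f : E → F} {c : E} {R M : ℝ} (hR : 0 < R)
    (hd : DifferentiableOn ℂ f (ball c R)) (hM : ∀ z ∈ ball c R, ‖f z‖ ≤ M) :
    ‖fderiv ℂ f c‖ ≤ 2 * M / R := by
  refine Complex.norm_fderiv_le_div_of_mapsTo_ball hd (fun z hz => ?_) hR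
  rw [mem_closedBall, dist_eq_norm]
  have h1 := hM z hz
  have h2 := hM c (mem_ball_self hR)
  linarith [norm_sub_le (f z) (f c)]

/-- A Schwarz lemma of order two: the remainder is `o(z - c)` and bounded by `4 * M` on the ball,
with `2 * M` from the increment of `f` and `2 * M` from the linear term. -/
theorem norm_sub_sub_fderiv_le {f : E → F} {c w : E} {R M : ℝ} (hR : 0 < R)
    (hd : DifferentiableOn ℂ f (ball c R)) (hM : ∀ z ∈ ball c R, ‖f z‖ ≤ M) (hw : ‖w‖ < R) :
    ‖f (c + w) - f c - fderiv ℂ f c w‖ ≤ 4 * M * (‖w‖ / R) ^ 2 := by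
  have hc : DifferentiableAt ℂ f c := hd.differentiableAt (ball_mem_nhds c hR)
  have key := Complex.dist_le_mul_div_pow_of_mapsTo_ball_of_isLittleO (n := 1)
    (f := fun z => f z - fderiv ℂ f c (z - c)) (c := c) (z := c + w) (R₁ := R) (R₂ := 4 * M)
    ?_ ?_ ?_ ?_
  · simpa [dist_eq_norm, sub_right_comm] using key
  · exact hd.sub (by fun_prop)
  · intro z hz
    rw [mem_closedBall, dist_eq_norm]
    have h1 := hM z hz
    have h2 := hM c (mem_ball_self hR)
    have h3 := (fderiv ℂ f c).le_opNorm (z - c)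
    have h4 := norm_fderiv_le_of_forall_mem_ball hR hd hM
    have h5 : ‖z - c‖ ≤ R := by rw [← dist_eq_norm]; exact (mem_ball.1 hz).le
    have h6 : ‖fderiv ℂ f c‖ * ‖z - c‖ ≤ 2 * M / R * R :=
      mul_le_mul h4 h5 (norm_nonneg _) ((norm_nonneg _).trans h4)
    rw [div_mul_cancel₀ _ hR.ne'] at h6
    have h7 : f z - fderiv ℂ f c (z - c) - (f c - fderiv ℂ f c (c - c)) =
        f z - f c - fderiv ℂ f c (z - c) := by simp; abel
    rw [h7]
    linarith [norm_sub_le (f z - f c) (fderiv ℂ f c (z - c)), norm_sub_le (f z) (f c)]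
  · have := hc.hasFDerivAt.isLittleO
    simp only [pow_one]
    refine (this.norm_right).congr_left fun z => ?_
    simp; abel
  · simpa [dist_eq_norm] using hw

/-- Uniform limits of holomorphic maps are holomorphic. -/
theorem differentiableOn_of_tendstoUniformlyOn [CompleteSpace F] {ι : Type*} {l : Filter ι}
    [NeBot l] {f : ι → E → F} {g : E → F} {s : Set E} (hs : IsOpen s)
    (hf : ∀ᶠ k in l, DifferentiableOn ℂ (f k) s) (h : TendstoUniformlyOn f g l s) :
    DifferentiableOn ℂ g s := by
  intro x hx
  obtain ⟨r, hr, hrs⟩ : ∃ r > 0, ball x (2 * r) ⊆ s := by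
    obtain ⟨ε, hε, h⟩ := Metric.isOpen_iff.1 hs x hx
    exact ⟨ε / 2, by positivity, by rwa [mul_div_cancel₀ _ two_ne_zero]⟩
  have hball : ∀ y ∈ ball x r, ball y r ⊆ s := fun y hy z hz => hrs <| by
    rw [mem_ball] at *
    linarith [dist_triangle z y x]
  -- Cauchy's estimate on balls of radius `r` turns uniform closeness `ε * r / 4` of the maps into
  -- closeness `ε / 2` of their derivatives.
  have hC : UniformCauchySeqOn (fun k => fderiv ℂ (f k)) l (ball x r) := by
    intro u hu
    obtain ⟨ε, hε, hεu⟩ := Metric.mem_uniformity_dist.1 hu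
    have h1 := h.uniformCauchySeqOn _ (Metric.dist_mem_uniformity (show 0 < ε * r / 4 by positivity))
    filter_upwards [h1, hf.prod_mk hf] with k hk hd y hy
    refine hεu ?_
    have hopen : ∀ j, DifferentiableOn ℂ (f j) s → DifferentiableAt ℂ (f j) y := fun j hj =>
      hj.differentiableAt (hs.mem_nhds (hball y hy (mem_ball_self hr)))
    rw [dist_eq_norm, ← fderiv_sub (hopen _ hd.1) (hopen _ hd.2)]
    refine (norm_fderiv_le_of_forall_mem_ball (M := ε * r / 4) hr
      ((hd.1.sub hd.2).mono (hball y hy)) fun z hz => ?_).trans_lt ?_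
    · have : dist (f k.1 z) (f k.2 z) < ε * r / 4 := hk z (hball y hy hz)
      rw [dist_eq_norm] at this
      exact this.le
    · field_simp; linarith
  have hlim : ∀ y ∈ ball x r, ∃ A, Tendsto (fun k => fderiv ℂ (f k) y) l (𝓝 A) := fun y hy =>
    CompleteSpace.complete (hC.cauchy_map hy)
  choose! g' hg' using hlim
  have hU := hC.tendstoUniformlyOn_of_tendsto hg'
  have hxs : ball x r ∈ 𝓝 x := ball_mem_nhds x hr
  refine (hasFDerivAt_of_tendstoUniformlyOnFilter (𝕜 := ℂ) (l := l) (f := f) (x := x)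
    (f' := fun k => fderiv ℂ (f k)) (g' := g') ?_ ?_ ?_).differentiableAt.differentiableWithinAt
  · rw [tendstoUniformlyOn_iff_tendstoUniformlyOnFilter] at hU
    exact hU.mono_right (le_principal_iff.2 hxs)
  · filter_upwards [hf.prod_mk (hs.mem_nhds hx)] with p hp
    exact (hp.1.differentiableAt (hs.mem_nhds hp.2)).hasFDerivAt
  · filter_upwards [hs.mem_nhds hx] with y hy using h.tendsto_at hy

theorem exists_ball_differentiableOn_bounded {f : E → F} {x : E}
    (hf : ∀ᶠ z in 𝓝 x, DifferentiableAt ℂ f z) :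
    ∃ R > 0, ∃ M > 0, DifferentiableOn ℂ f (ball x R) ∧ ∀ z ∈ ball x R, ‖f z‖ ≤ M := by
  have h1 : ∀ᶠ z in 𝓝 x, ‖f z‖ < ‖f x‖ + 1 :=
    hf.self_of_nhds.continuousAt.norm.eventually_lt continuousAt_const (by simp)
  obtain ⟨R, hR, h⟩ := Metric.eventually_nhds_iff_ball.1 (hf.and h1)
  exact ⟨R, hR, ‖f x‖ + 1, by positivity, fun z hz => (h z hz).1.differentiableWithinAt,
    fun z hz => (h z hz).2.le⟩

theorem differentiableOn_clm_apply [FiniteDimensional ℂ E] {G : Type*} [NormedAddCommGroup G]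
    [NormedSpace ℂ G] {f : G → E →L[ℂ] F} {s : Set G} :
    DifferentiableOn ℂ f s ↔ ∀ y, DifferentiableOn ℂ (fun x => f x y) s := by
  refine ⟨fun h y => h.clm_apply (differentiableOn_const y), fun h => ?_⟩
  let e : (E →L[ℂ] F) ≃L[ℂ] Fin (Module.finrank ℂ E) → F :=
    ((ContinuousLinearEquiv.ofFinrankEq (Module.finrank_fin_fun ℂ).symm).arrowCongr
      (1 : F ≃L[ℂ] F)).trans (ContinuousLinearEquiv.piRing _)
  rw [← e.comp_differentiableOn_iff]
  exact differentiableOn_pi.2 fun i => h _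

/-- The derivative of a holomorphic map is holomorphic. -/
theorem eventually_differentiableAt_fderiv [FiniteDimensional ℂ E] [CompleteSpace F] {f : E → F}
    {x : E} (hf : ∀ᶠ z in 𝓝 x, DifferentiableAt ℂ f z) :
    ∀ᶠ z in 𝓝 x, DifferentiableAt ℂ (fderiv ℂ f) z := by
  obtain ⟨R', hR', M, hM, hd, hb⟩ := exists_ball_differentiableOn_bounded hf
  obtain ⟨R, rfl⟩ : ∃ R, R' = 2 * R := ⟨R' / 2, by ring⟩
  have hR : 0 < R := by linarith
  have hball : ∀ y ∈ ball x R, ball y R ⊆ ball x (2 * R) := fun y hy z hz => by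
    rw [mem_ball] at *
    linarith [dist_triangle z y x]
  have key : DifferentiableOn ℂ (fderiv ℂ f) (ball x R) := by
    rw [differentiableOn_clm_apply]
    intro v
    have hsmall : ∀ᶠ h : ℂ in 𝓝[≠] 0, ‖h • v‖ < R := by
      refine nhdsWithin_le_nhds ?_
      have : ContinuousAt (fun h : ℂ => ‖h • v‖) 0 := by fun_prop
      exact this.eventually_lt continuousAt_const (by simpa using hR)
    -- The directional derivative is a uniform limit of holomorphic difference quotients; the
    -- quadratic remainder bound makes the error `O(‖h‖)` uniformly in `y`.
    refine differentiableOn_of_tendstoUniformlyOn (l := 𝓝[≠] (0 : ℂ))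
      (f := fun h y => h⁻¹ • (f (y + h • v) - f y)) isOpen_ball ?_ ?_
    · filter_upwards [hsmall] with h hh
      refine DifferentiableOn.const_smul (DifferentiableOn.sub ?_ ?_) _
      · refine hd.comp (t := ball x (2 * R)) (by fun_prop) fun y hy => hball y hy ?_
        simpa [dist_eq_norm] using hh
      · exact hd.mono (ball_subset_ball (by linarith))
    · rw [Metric.tendstoUniformlyOn_iff]
      intro ε hε
      have hsmall' : ∀ᶠ h : ℂ in 𝓝[≠] 0, ‖h‖ * (4 * M * (‖v‖ / R) ^ 2) < ε := by
        refine nhdsWithin_le_nhds ?_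
        have : ContinuousAt (fun h : ℂ => ‖h‖ * (4 * M * (‖v‖ / R) ^ 2)) 0 := by fun_prop
        exact this.eventually_lt continuousAt_const (by simpa using hε)
      filter_upwards [hsmall, hsmall', self_mem_nhdsWithin] with h h1 h2 h3 y hy
      have h0 : h ≠ 0 := h3
      have h4 := norm_sub_sub_fderiv_le hR (hd.mono (hball y hy))
        (fun z hz => hb z (hball y hy hz)) h1
      rw [dist_eq_norm, norm_sub_rev]
      have h5 : h⁻¹ • (f (y + h • v) - f y) - fderiv ℂ f y v =
          h⁻¹ • (f (y + h • v) - f y - fderiv ℂ f y (h • v)) := by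
        rw [smul_sub h⁻¹ (f (y + h • v) - f y), map_smul, inv_smul_smul₀ h0]
      rw [h5, norm_smul, norm_inv]
      refine lt_of_le_of_lt ?_ h2
      have hpos : 0 < ‖h‖ := norm_pos_iff.2 h0
      calc ‖h‖⁻¹ * ‖f (y + h • v) - f y - fderiv ℂ f y (h • v)‖
          ≤ ‖h‖⁻¹ * (4 * M * (‖h • v‖ / R) ^ 2) := by gcongr
        _ = ‖h‖ * (4 * M * (‖v‖ / R) ^ 2) := by rw [norm_smul]; field_simp
  filter_upwards [ball_mem_nhds x hR] with z hz
  exact key.differentiableAt (isOpen_ball.mem_nhds hz)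

/-- Cauchy's estimate on the ball of radius `ε` about `z`, with `ε` decreasing to `‖z‖`. Passing to
the limit, rather than taking `ε = ‖z‖`, also covers `z = 0`. -/
theorem isBigO_fderiv_of_isBigO {f : E → F} {d : ℕ}
    (hf : ∀ᶠ z in 𝓝 0, DifferentiableAt ℂ f z) (hd : f =O[𝓝 0] fun z => ‖z‖ ^ (d + 1)) :
    fderiv ℂ f =O[𝓝 0] fun z => ‖z‖ ^ d := by
  obtain ⟨C, hC, hb⟩ := hd.exists_pos
  obtain ⟨R, hR, h⟩ := Metric.eventually_nhds_iff_ball.1 (hf.and hb.bound)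
  refine IsBigO.of_bound (2 ^ (d + 2) * C) ?_
  filter_upwards [ball_mem_nhds (0 : E) (half_pos hR)] with z hz
  rw [mem_ball_zero_iff] at hz
  have hlim : Tendsto (fun ε : ℝ => 2 ^ (d + 2) * C * ε ^ d) (𝓝[>] ‖z‖)
      (𝓝 (2 ^ (d + 2) * C * ‖z‖ ^ d)) := by
    refine Tendsto.mono_left (Continuous.tendsto ?_ _) nhdsWithin_le_nhds
    fun_prop
  rw [norm_pow, norm_norm]
  refine ge_of_tendsto hlim ?_
  filter_upwards [Ioo_mem_nhdsGT hz] with ε hε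
  have hε0 : 0 < ε := (norm_nonneg z).trans_lt hε.1
  have hsub : ∀ w ∈ ball z ε, ‖w‖ < 2 * ε := fun w hw => by
    rw [mem_ball, dist_eq_norm] at hw
    linarith [norm_le_norm_sub_add w z, hε.1]
  have hsub' : ∀ w ∈ ball z ε, w ∈ ball (0 : E) R := fun w hw => by
    rw [mem_ball_zero_iff]
    linarith [hsub w hw, hε.2]
  refine (norm_fderiv_le_of_forall_mem_ball (M := C * (2 * ε) ^ (d + 1)) hε0
    (fun w hw => (h w (hsub' w hw)).1.differentiableWithinAt) fun w hw => ?_).trans_eq ?_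
  · have h1 := (h w (hsub' w hw)).2
    rw [norm_pow, norm_norm] at h1
    refine h1.trans ?_
    gcongr
    exact (hsub w hw).le
  · field_simp
    ring

end Holomorphic

/-! ### Leading homogeneous terms of holomorphic germs. -/

section Taylor

open Metric Set Filter Asymptotics

universe u
variable {E : Type u} [NormedAddCommGroup E] [NormedSpace ℂ E]

/-- A holomorphic germ vanishing to order `d` agrees to order `d + 1` with a homogeneous
polynomial of degree `d`. -/
theorem exists_multilinear_isBigO [FiniteDimensional ℂ E] (d : ℕ) :
    ∀ {F : Type u} [NormedAddCommGroup F] [NormedSpace ℂ F] [CompleteSpace F] {f : E → F},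
    (∀ᶠ z in 𝓝 0, DifferentiableAt ℂ f z) → (f =O[𝓝 0] fun z => ‖z‖ ^ d) →
    ∃ M : ContinuousMultilinearMap ℂ (fun _ : Fin d => E) F,
      (fun z => f z - M fun _ => z) =O[𝓝 0] fun z => ‖z‖ ^ (d + 1) := by
  induction d with
  | zero =>
    intro F _ _ _ f hf _
    refine ⟨ContinuousMultilinearMap.constOfIsEmpty ℂ _ (f 0), ?_⟩
    have := hf.self_of_nhds.isBigO_sub
    simpa using this.norm_right
  | succ d ih =>
    intro F _ _ _ f hf hd
    obtain ⟨N, hN⟩ := ih (eventually_differentiableAt_fderiv hf) (isBigO_fderiv_of_isBigO hf hd)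
    have hf0 : f 0 = 0 := by
      obtain ⟨C, hC⟩ := hd.bound
      simpa using hC.self_of_nhds
    -- `N` is the leading term of the derivative; integrating `t ^ d • N (z, …, z) z` along the ray
    -- from `0` to `z` produces the factor `1 / (d + 1)`.
    refine ⟨((d : ℂ) + 1)⁻¹ • ContinuousMultilinearMap.uncurryRight (Ei := fun _ => E) N, ?_⟩
    obtain ⟨C, hC, hb⟩ := hN.exists_pos
    obtain ⟨R, hR, h⟩ := Metric.eventually_nhds_iff_ball.1 (hf.and hb.bound)
    refine IsBigO.of_bound C ?_
    filter_upwards [ball_mem_nhds (0 : E) hR] with z hz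
    rw [mem_ball_zero_iff] at hz
    have hd0 : (d : ℂ) + 1 ≠ 0 := by exact_mod_cast d.succ_ne_zero
    have hmem : ∀ t ∈ closedBall (0 : ℂ) 1, t • z ∈ ball (0 : E) R ∧ ‖t • z‖ ≤ ‖z‖ := fun t ht => by
      rw [mem_closedBall_zero_iff] at ht
      have h1 : ‖t • z‖ ≤ ‖z‖ := by
        rw [norm_smul]
        exact mul_le_of_le_one_left (norm_nonneg _) ht
      exact ⟨by rw [mem_ball_zero_iff]; linarith, h1⟩
    have key := (convex_closedBall (0 : ℂ) 1).norm_image_sub_le_of_norm_hasDerivWithin_le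
      (f := fun t : ℂ => f (t • z) - (t ^ (d + 1) * ((d : ℂ) + 1)⁻¹) • N (fun _ => z) z)
      (f' := fun t => (fderiv ℂ f (t • z) - N fun _ => t • z) z) (C := C * ‖z‖ ^ (d + 2))
      (x := 0) (y := 1) ?_ ?_ (by simp) (by simp)
    · have h1 : (Fin.init fun _ : Fin (d + 1) => z) = fun _ => z := rfl
      simpa [hf0, h1] using key
    · intro t ht
      refine HasDerivAt.hasDerivWithinAt ?_
      have h1 : HasDerivAt (fun t : ℂ => f (t • z)) (fderiv ℂ f (t • z) z) t := by
        have := (h _ (hmem t ht).1).1.hasFDerivAt.comp_hasDerivAt t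
          ((hasDerivAt_id t).smul_const z)
        simpa [Function.comp_def] using this
      have h2 : HasDerivAt (fun t : ℂ => (t ^ (d + 1) * ((d : ℂ) + 1)⁻¹) • N (fun _ => z) z)
          ((t ^ d) • N (fun _ => z) z) t := by
        have := (((hasDerivAt_pow (d + 1) t).mul_const ((d : ℂ) + 1)⁻¹)).smul_const
          (N (fun _ => z) z)
        convert this using 2
        push_cast
        field_simp
      have h3 : (N fun _ => t • z) = t ^ d • N fun _ => z := by
        simpa using N.map_smul_univ (fun _ => t) (fun _ => z)
      have := h1.fun_sub h2
      simpa [h3] using this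
    · intro t ht
      refine (ContinuousLinearMap.le_opNorm _ _).trans ?_
      have h1 := (h _ (hmem t ht).1).2
      rw [norm_pow, norm_norm] at h1
      calc _ ≤ C * ‖z‖ ^ (d + 1) * ‖z‖ := by
            gcongr
            refine h1.trans ?_
            gcongr
            exact (hmem t ht).2
        _ = _ := by ring

end Taylor

/-! ### Spectral projections and growth of powers. -/

section LinearPart

open Filter Asymptotics Module.End

variable {E : Type*} [NormedAddCommGroup E] [NormedSpace ℂ E] [FiniteDimensional ℂ E]

/-- Gelfand's formula: the eigenvalue bound controls the spectral radius, because nonzero spectrum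
of a compact operator consists of eigenvalues. -/
theorem exists_norm_pow_le_of_eigenvalues {B : E →L[ℂ] E} {r ρ : ℝ} (hr : 0 ≤ r) (hrρ : r < ρ)
    (h : ∀ μ : ℂ, HasEigenvalue B.toLinearMap μ → ‖μ‖ ≤ r) :
    ∃ C > 0, ∀ k : ℕ, ‖B ^ k‖ ≤ C * ρ ^ k := by
  have : CompleteSpace E := FiniteDimensional.complete ℂ E
  have : ProperSpace E := FiniteDimensional.proper ℂ E
  have hρ : 0 < ρ := hr.trans_lt hrρ
  have hB : IsCompactOperator B := isCompactOperator_of_locallyCompactSpace_dom (T := B)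
  have hspec : spectralRadius ℂ B < ENNReal.ofReal ρ := by
    refine lt_of_le_of_lt (b := ENNReal.ofReal r) ?_ ((ENNReal.ofReal_lt_ofReal_iff hρ).2 hrρ)
    refine iSup₂_le fun μ hμ => ?_
    rw [← enorm_eq_nnnorm, ← ofReal_norm]
    refine ENNReal.ofReal_le_ofReal ?_
    rcases eq_or_ne μ 0 with rfl | h0
    · simpa using hr
    · exact h μ ((hB.hasEigenvalue_or_mem_resolventSet h0).resolve_right hμ)
  have hev := (spectrum.pow_norm_pow_one_div_tendsto_nhds_spectralRadius B).eventually_lt_const hspec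
  have hO : (fun k : ℕ => B ^ k) =O[atTop] fun k : ℕ => ρ ^ k := by
    refine IsBigO.of_bound 1 ?_
    filter_upwards [hev, eventually_gt_atTop 0] with k hk hk0
    rw [ENNReal.ofReal_lt_ofReal_iff hρ] at hk
    have h1 := pow_le_pow_left₀ (by positivity) hk.le k
    rw [one_div, Real.rpow_inv_natCast_pow (norm_nonneg _) hk0.ne'] at h1
    rwa [one_mul, Real.norm_of_nonneg (by positivity)]
  obtain ⟨C, hC, hb⟩ := bound_of_isBigO_nat_atTop hO
  refine ⟨C, hC, fun k => ?_⟩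
  simpa [abs_of_pos hρ] using hb (x := k) (by positivity)

/-- Apply the previous bound to `A * p`: its eigenvectors for nonzero eigenvalues lie in the range
of `p`, where they are eigenvectors of `A`. -/
theorem exists_norm_pow_mul_le_of_eigenvalues {A p : E →L[ℂ] E} {r ρ : ℝ} (hr : 0 ≤ r)
    (hrρ : r < ρ) (hc : Commute A p) (hp : IsIdempotentElem p)
    (h : ∀ (c : ℂ) (x : E), x ≠ 0 → p x = x → A x = c • x → ‖c‖ ≤ r) :
    ∃ C > 0, ∀ k : ℕ, ‖A ^ k * p‖ ≤ C * ρ ^ k := by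
  obtain ⟨C, hC, hb⟩ := exists_norm_pow_le_of_eigenvalues (B := A * p) hr hrρ <| by
    intro c hev
    obtain ⟨x, hx⟩ := hev.exists_hasEigenvector
    have hAx : A (p x) = c • x := hx.apply_eq_smul
    rcases eq_or_ne c 0 with rfl | h0
    · simpa using hr
    have hpx : p x = x := by
      have h1 : p (A (p x)) = A (p x) := by
        rw [← mul_apply_eq_comp p A, ← hc.eq, mul_apply_eq_comp,
          ← mul_apply_eq_comp p p, hp.eq]
      rw [hAx, map_smul] at h1
      exact smul_right_injective E h0 h1
    exact h c x hx.2 hpx (by rw [← hAx, hpx])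
  refine ⟨C * (‖p‖ + 1), by positivity, fun k => ?_⟩
  have hk : A ^ k * p = (A * p) ^ k * p := by
    rw [hc.mul_pow, mul_assoc, ← pow_succ, hp.pow_succ_eq]
  have hρ : 0 < ρ := hr.trans_lt hrρ
  calc ‖A ^ k * p‖ ≤ ‖(A * p) ^ k‖ * ‖p‖ := by rw [hk]; exact norm_mul_le _ _
    _ ≤ C * ρ ^ k * (‖p‖ + 1) := by
      gcongr
      · exact hb k
      · linarith
    _ = _ := by ring

theorem DirectSum.IsInternal.exists_projections {ι : Type*} [Fintype ι] [DecidableEq ι]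
    {V : ι → Submodule ℂ E} (hint : DirectSum.IsInternal V) :
    ∃ π : ι → E →L[ℂ] E, (∀ i x, π i x ∈ V i) ∧ (∀ x, ∑ i, π i x = x) ∧
      (∀ i, ∀ x ∈ V i, π i x = x) ∧ (∀ i j, i ≠ j → ∀ x ∈ V j, π i x = 0) := by
  classical
  let e := LinearEquiv.ofBijective (DirectSum.coeLinearMap V) hint
  refine ⟨fun i => LinearMap.toContinuousLinearMap
    ((V i).subtype ∘ₗ DirectSum.component ℂ _ _ i ∘ₗ e.symm.toLinearMap), ?_, ?_, ?_, ?_⟩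
  · intro i x
    exact Subtype.coe_prop _
  · intro x
    conv_rhs => rw [← e.apply_symm_apply x]
    have h1 : e (e.symm x) = DirectSum.coeLinearMap V (e.symm x) := rfl
    rw [h1, DirectSum.coeLinearMap_eq_dfinsuppSum, DFinsupp.sum_eq_sum_fintype]
    · rfl
    · simp
  · intro i x hx
    exact congrArg Subtype.val (hint.ofBijective_coeLinearMap_of_mem hx)
  · intro i j hij x hx
    exact congrArg Subtype.val (hint.ofBijective_coeLinearMap_of_mem_ne hij.symm hx)

/-- `π` is the family of projections attached to the decomposition of the space into the
generalized eigenspaces of `L`. -/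
structure IsSpectralProjection (L : E →L[ℂ] E) (π : Eigenvalues L.toLinearMap → E →L[ℂ] E) :
    Prop where
  mem : ∀ (μ : Eigenvalues L.toLinearMap) (x : E), π μ x ∈ maxGenEigenspace L.toLinearMap (μ : ℂ)
  sum : ∀ x : E, ∑ μ, π μ x = x
  of_mem : ∀ μ : Eigenvalues L.toLinearMap,
    ∀ x ∈ maxGenEigenspace L.toLinearMap (μ : ℂ), π μ x = x
  of_mem_ne : ∀ μ ν : Eigenvalues L.toLinearMap, μ ≠ ν →
    ∀ x ∈ maxGenEigenspace L.toLinearMap (ν : ℂ), π μ x = 0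

theorem exists_isSpectralProjection (L : E →L[ℂ] E) :
    ∃ π : Eigenvalues L.toLinearMap → E →L[ℂ] E, IsSpectralProjection L π := by
  classical
  have hint : DirectSum.IsInternal
      fun μ : Eigenvalues L.toLinearMap => maxGenEigenspace L.toLinearMap (μ : ℂ) := by
    rw [DirectSum.isInternal_submodule_iff_iSupIndep_and_iSup_eq_top]
    refine ⟨(independent_maxGenEigenspace L.toLinearMap).comp Subtype.val_injective, ?_⟩
    rw [eq_top_iff, ← iSup_maxGenEigenspace_eq_top L.toLinearMap]
    refine iSup_le fun μ => ?_
    by_cases hμ : HasEigenvalue L.toLinearMap μ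
    · exact le_iSup (fun μ : Eigenvalues L.toLinearMap =>
        maxGenEigenspace L.toLinearMap (μ : ℂ)) ⟨μ, hμ⟩
    · have : maxGenEigenspace L.toLinearMap μ = ⊥ := by
        by_contra h
        have h' : HasUnifEigenvalue L.toLinearMap μ ⊤ := h
        exact hμ (h'.lt zero_lt_one)
      rw [this]
      exact bot_le
  obtain ⟨π, h1, h2, h3, h4⟩ := hint.exists_projections
  exact ⟨π, h1, h2, h3, h4⟩

namespace IsSpectralProjection

variable {L : E →L[ℂ] E} {π : Eigenvalues L.toLinearMap → E →L[ℂ] E}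

theorem map_mem {E : Type*} [NormedAddCommGroup E] [NormedSpace ℂ E] {L : E →L[ℂ] E} {μ : ℂ} {x : E} (hx : x ∈ maxGenEigenspace L.toLinearMap μ) :
    L x ∈ maxGenEigenspace L.toLinearMap μ :=
  mapsTo_maxGenEigenspace_of_comm (Commute.refl L.toLinearMap) μ hx

theorem apply_sum (h : IsSpectralProjection L π) {t : Eigenvalues L.toLinearMap → E}
    (ht : ∀ μ : Eigenvalues L.toLinearMap, t μ ∈ maxGenEigenspace L.toLinearMap (μ : ℂ))
    (ν : Eigenvalues L.toLinearMap) : π ν (∑ μ, t μ) = t ν := by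
  rw [map_sum, Finset.sum_eq_single ν]
  · exact h.of_mem ν _ (ht ν)
  · exact fun μ _ hμ => h.of_mem_ne ν μ hμ.symm _ (ht μ)
  · simp

theorem comm (h : IsSpectralProjection L π) (μ : Eigenvalues L.toLinearMap) (x : E) :
    π μ (L x) = L (π μ x) := by
  conv_lhs => rw [← h.sum x, map_sum]
  exact h.apply_sum (fun ν => map_mem (h.mem ν x)) μ

theorem idem (h : IsSpectralProjection L π) (μ : Eigenvalues L.toLinearMap) (x : E) :
    π μ (π μ x) = π μ x :=
  h.of_mem μ _ (h.mem μ x)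

theorem eq_of_eigenvector (h : IsSpectralProjection L π) {μ : Eigenvalues L.toLinearMap} {x : E}
    {c : ℂ} (hx : x ≠ 0) (hπ : π μ x = x) (hc : L x = c • x) : c = μ := by
  have hev : HasEigenvalue L.toLinearMap c :=
    hasEigenvalue_of_hasEigenvector (hasEigenvector_iff.2 ⟨mem_eigenspace_iff.2 hc, hx⟩)
  by_contra hne
  have hmem : x ∈ maxGenEigenspace L.toLinearMap c :=
    eigenspace_le_maxGenEigenspace (mem_eigenspace_iff.2 hc)
  have := h.of_mem_ne μ ⟨c, hev⟩ (fun h => hne (congrArg Subtype.val h).symm) x hmem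
  exact hx (hπ.symm.trans this)

theorem exists_norm_pow_mul_le (h : IsSpectralProjection L π) (μ : Eigenvalues L.toLinearMap)
    {ρ : ℝ} (hρ : ‖(μ : ℂ)‖ < ρ) : ∃ C > 0, ∀ k : ℕ, ‖L ^ k * π μ‖ ≤ C * ρ ^ k := by
  refine exists_norm_pow_mul_le_of_eigenvalues (norm_nonneg _) hρ ?_ ?_ ?_
  · ext x; exact (h.comm μ x).symm
  · ext x; exact h.idem μ x
  · intro c x hx hp hL
    rw [h.eq_of_eigenvector hx hp hL]

theorem exists_norm_inv_pow_mul_le (h : IsSpectralProjection L π) {L' : E →L[ℂ] E}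
    (hL : ∀ x, L (L' x) = x) (hL' : ∀ x, L' (L x) = x) (μ : Eigenvalues L.toLinearMap)
    {ρ : ℝ} (hρ : ‖(μ : ℂ)‖⁻¹ < ρ) : ∃ C > 0, ∀ k : ℕ, ‖L' ^ k * π μ‖ ≤ C * ρ ^ k := by
  refine exists_norm_pow_mul_le_of_eigenvalues (r := ‖(μ : ℂ)‖⁻¹) (by positivity) hρ ?_ ?_ ?_
  · ext x
    change L' (π μ x) = π μ (L' x)
    rw [← hL' (π μ (L' x)), ← h.comm, hL]
  · ext x; exact h.idem μ x
  · intro c x hx hp hc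
    have hc0 : c ≠ 0 := by
      rintro rfl
      rw [zero_smul] at hc
      exact hx (by rw [← hL x, hc, map_zero])
    have : L x = c⁻¹ • x := by
      rw [eq_inv_smul_iff₀ hc0, ← map_smul, ← hc, hL]
    rw [← h.eq_of_eigenvector hx hp this, norm_inv, inv_inv]

end IsSpectralProjection

end LinearPart

/-! ### The linearised conjugacy equation. -/

section Cohomological

open Filter Module.End

variable {E : Type*} [NormedAddCommGroup E] [NormedSpace ℂ E] [FiniteDimensional ℂ E]
  {L L' : E →L[ℂ] E} {π : Eigenvalues L.toLinearMap → E →L[ℂ] E}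

theorem eigenvalue_ne_zero {E : Type*} [NormedAddCommGroup E] [NormedSpace ℂ E]
    {L L' : E →L[ℂ] E} (hL' : ∀ x, L' (L x) = x) (μ : Eigenvalues L.toLinearMap) :
    (μ : ℂ) ≠ 0 := by
  intro h0
  obtain ⟨x, hx⟩ := HasUnifEigenvalue.exists_hasUnifEigenvector μ.2
  have h1 : L x = (μ : ℂ) • x := HasEigenvector.apply_eq_smul hx
  rw [h0, zero_smul] at h1
  exact hx.2 (by rw [← hL' x, h1, map_zero])

namespace IsSpectralProjection

/-- The operator `H ↦ L ∘ H - H ∘ L` can be solved on the terms that are not sub-resonant. -/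
theorem exists_cohomological (h : IsSpectralProjection L π)
    (hL : ∀ x, L (L' x) = x) (hL' : ∀ x, L' (L x) = x) {d : ℕ}
    (M : ContinuousMultilinearMap ℂ (fun _ : Fin d => E) E) (μ : Eigenvalues L.toLinearMap)
    (ν : Fin d → Eigenvalues L.toLinearMap) (hlt : ∏ j, ‖(ν j : ℂ)‖ < ‖(μ : ℂ)‖) :
    ∃ H : ContinuousMultilinearMap ℂ (fun _ : Fin d => E) E,
      ∀ z, L (H fun _ => z) - H (fun _ => L z) = π μ (M fun j => π (ν j) z) := by
  have : CompleteSpace E := FiniteDimensional.complete ℂ E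
  have hμ : 0 < ‖(μ : ℂ)‖ := norm_pos_iff.2 (eigenvalue_ne_zero hL' μ)
  -- The growth bounds on powers need rates strictly above the eigenvalue moduli; `θ` is slightly
  -- larger than `1`, so that the geometric ratio of the series stays below `1`.
  obtain ⟨θ, hθ, hθ1⟩ : ∃ θ : ℝ, θ * ‖(μ : ℂ)‖⁻¹ * ∏ j, (θ * ‖(ν j : ℂ)‖) < 1 ∧ 1 < θ := by
    have hc : ContinuousAt (fun θ : ℝ => θ * ‖(μ : ℂ)‖⁻¹ * ∏ j, (θ * ‖(ν j : ℂ)‖)) 1 := by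
      fun_prop
    have h1 := hc.eventually_lt (continuousAt_const (y := (1 : ℝ))) (by
      simpa [inv_mul_lt_iff₀ hμ] using hlt)
    exact ((h1.filter_mono nhdsWithin_le_nhds).and
      (self_mem_nhdsWithin : Set.Ioi (1 : ℝ) ∈ 𝓝[>] 1)).exists
  obtain ⟨C, hC, hCb⟩ := h.exists_norm_inv_pow_mul_le hL hL' μ (ρ := θ * ‖(μ : ℂ)‖⁻¹)
    (lt_mul_of_one_lt_left (by positivity) hθ1)
  have hν : ∀ j, ∃ D > 0, ∀ k : ℕ, ‖L ^ k * π (ν j)‖ ≤ D * (θ * ‖(ν j : ℂ)‖) ^ k := fun j =>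
    h.exists_norm_pow_mul_le (ν j)
      (lt_mul_of_one_lt_left (norm_pos_iff.2 (eigenvalue_ne_zero hL' (ν j))) hθ1)
  choose D hD hDb using hν
  have hθ0 : 0 < θ := one_pos.trans hθ1
  -- The terms `L⁻ᵏ⁻¹ ∘ M ∘ Lᵏ` of the projected `M`. Applying `L` on the left gives `a k` and
  -- precomposing with `L` gives `a (k + 1)`, so the difference telescopes to `a 0`.
  let T : ℕ → ContinuousMultilinearMap ℂ (fun _ : Fin d => E) E := fun k =>
    (L' ^ (k + 1) * π μ).compContinuousMultilinearMap
      (M.compContinuousLinearMap fun j => L ^ k * π (ν j))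
  have hT : Summable T := by
    refine Summable.of_norm_bounded (g := fun k => C * (θ * ‖(μ : ℂ)‖⁻¹) * (‖M‖ * ∏ j, D j) *
      (θ * ‖(μ : ℂ)‖⁻¹ * ∏ j, (θ * ‖(ν j : ℂ)‖)) ^ k) ?_ fun k => ?_
    · exact (summable_geometric_of_lt_one (by positivity) hθ).mul_left _
    · calc ‖T k‖ ≤ ‖L' ^ (k + 1) * π μ‖ * (‖M‖ * ∏ j, ‖L ^ k * π (ν j)‖) :=
            (ContinuousLinearMap.norm_compContinuousMultilinearMap_le _ _).trans
              (mul_le_mul_of_nonneg_left (M.norm_compContinuousLinearMap_le _) (norm_nonneg _))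
        _ ≤ C * (θ * ‖(μ : ℂ)‖⁻¹) ^ (k + 1) * (‖M‖ * ∏ j, (D j * (θ * ‖(ν j : ℂ)‖) ^ k)) := by
            gcongr with j
            · exact hCb _
            · exact hDb j k
        _ = _ := by
            rw [Finset.prod_mul_distrib, Finset.prod_pow, mul_pow _ _ k, pow_succ]
            ring
  refine ⟨∑' k, T k, fun z => ?_⟩
  let a : ℕ → E := fun k => (L' ^ k) (π μ (M fun j => (L ^ k) (π (ν j) z)))
  have h1 : ∀ k, L (T k fun _ => z) = a k := fun k => by
    change L ((L' ^ (k + 1)) _) = _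
    rw [pow_succ', mul_apply_eq_comp, hL]
    rfl
  have h2 : ∀ k, (T k fun _ => L z) = a (k + 1) := fun k => by
    change (L' ^ (k + 1)) (π μ (M fun j => (L ^ k) (π (ν j) (L z)))) = _
    simp only [a, h.comm, pow_succ L k, mul_apply_eq_comp]
  have hsum : ∀ w, HasSum (fun k => T k w) ((∑' k, T k) w) := fun w =>
    ContinuousMultilinearMap.hasSum_eval hT.hasSum w
  have h3 : HasSum a (L ((∑' k, T k) fun _ => z)) := by
    have := (hsum fun _ => z).mapL L
    simpa only [h1] using this
  have h4 : HasSum (fun k => a (k + 1)) ((∑' k, T k) fun _ => L z) := by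
    simpa only [h2] using hsum fun _ => L z
  rw [← h3.tsum_eq, ← h4.tsum_eq, h3.summable.tsum_eq_zero_add, add_sub_cancel_right]
  simp [a]

theorem eq_sum_terms (h : IsSpectralProjection L π) {d : ℕ}
    (M : ContinuousMultilinearMap ℂ (fun _ : Fin d => E) E) (z : E) :
    (M fun _ => z) = ∑ p : Eigenvalues L.toLinearMap × (Fin d → Eigenvalues L.toLinearMap),
      π p.1 (M fun j => π (p.2 j) z) := by
  classical
  rw [Fintype.sum_prod_type, Finset.sum_comm]
  simp_rw [h.sum]
  have := M.toMultilinearMap.map_sum fun (_ : Fin d) μ => π μ z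
  simpa [h.sum] using this

open Classical in
theorem exists_subresonant_reduction (h : IsSpectralProjection L π)
    (hL : ∀ x, L (L' x) = x) (hL' : ∀ x, L' (L x) = x) {d : ℕ}
    (M : ContinuousMultilinearMap ℂ (fun _ : Fin d => E) E) :
    ∃ H : ContinuousMultilinearMap ℂ (fun _ : Fin d => E) E, ∀ z,
      (M fun _ => z) + (L (H fun _ => z) - H fun _ => L z) =
        ∑ p : Eigenvalues L.toLinearMap × (Fin d → Eigenvalues L.toLinearMap)
          with ‖(p.1 : ℂ)‖ ≤ ∏ j, ‖(p.2 j : ℂ)‖, π p.1 (M fun j => π (p.2 j) z) := by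
  have hex : ∀ p : Eigenvalues L.toLinearMap × (Fin d → Eigenvalues L.toLinearMap),
      ∃ H : ContinuousMultilinearMap ℂ (fun _ : Fin d => E) E,
        ¬ ‖(p.1 : ℂ)‖ ≤ ∏ j, ‖(p.2 j : ℂ)‖ →
        ∀ z, L (H fun _ => z) - H (fun _ => L z) = π p.1 (M fun j => π (p.2 j) z) := fun p => by
    by_cases hp : ‖(p.1 : ℂ)‖ ≤ ∏ j, ‖(p.2 j : ℂ)‖
    · exact ⟨0, fun h => (h hp).elim⟩
    · obtain ⟨H, hH⟩ := h.exists_cohomological hL hL' M p.1 p.2 (not_le.1 hp)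
      exact ⟨H, fun _ => hH⟩
  choose H hH using hex
  refine ⟨-∑ p with ¬ ‖(p.1 : ℂ)‖ ≤ ∏ j, ‖(p.2 j : ℂ)‖, H p, fun z => ?_⟩
  rw [h.eq_sum_terms M z, ← Finset.sum_filter_add_sum_filter_not Finset.univ
    (fun p : Eigenvalues L.toLinearMap × (Fin d → Eigenvalues L.toLinearMap) =>
      ‖(p.1 : ℂ)‖ ≤ ∏ j, ‖(p.2 j : ℂ)‖), add_assoc, add_eq_left]
  rw [← Finset.sum_congr rfl fun p hp => hH p (Finset.mem_filter.1 hp).2 z]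
  simp only [neg_apply, sum_apply, map_neg,
    map_sum, Finset.sum_sub_distrib]
  abel

end IsSpectralProjection

end Cohomological

/-! ### Homogeneous types and sub-resonant sums. -/

section Types

open Module.End SubResonance

variable {n : ℕ}

theorem isHomogeneousPolynomialMap_diag {d : ℕ}
    (M : ContinuousMultilinearMap ℂ (fun _ : Fin d => (Fin n → ℂ)) (Fin n → ℂ)) :
    IsHomogeneousPolynomialMap d fun z => M fun _ => z := by
  classical
  refine ⟨fun i => ∑ f : Fin d → Fin n, MvPolynomial.C (M (fun j => Pi.single (f j) 1) i) *
    ∏ j, MvPolynomial.X (f j), fun i => ?_, fun z i => ?_⟩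
  · refine MvPolynomial.IsHomogeneous.sum _ _ _ fun f _ => ?_
    have h := (MvPolynomial.isHomogeneous_C (Fin n) (M (fun j => Pi.single (f j) 1) i)).mul
      (MvPolynomial.IsHomogeneous.prod Finset.univ (fun j : Fin d => MvPolynomial.X (f j))
        (fun _ => 1) fun j _ => MvPolynomial.isHomogeneous_X ℂ (f j))
    simpa using h
  · have hz : z = ∑ k, z k • (Pi.single k 1 : Fin n → ℂ) := by
      simpa using pi_eq_sum_univ' z
    have h1 : (M fun _ => z) = ∑ f : Fin d → Fin n,
        (∏ j, z (f j)) • M fun j => (Pi.single (f j) 1 : Fin n → ℂ) := by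
      conv_lhs => rw [hz]
      have := M.toMultilinearMap.map_sum
        fun (_ : Fin d) k => z k • (Pi.single k 1 : Fin n → ℂ)
      refine this.trans (Finset.sum_congr rfl fun f _ => ?_)
      exact M.toMultilinearMap.map_smul_univ (fun j => z (f j)) fun j => Pi.single (f j) 1
    change (M fun _ => z) i = _
    rw [h1]
    simp [Finset.sum_apply, mul_comm]

theorem SubResonance.IsHomogeneousPolynomialMap.add {d : ℕ} {P Q : (Fin n → ℂ) → (Fin n → ℂ)}
    (hP : IsHomogeneousPolynomialMap d P) (hQ : IsHomogeneousPolynomialMap d Q) :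
    IsHomogeneousPolynomialMap d (P + Q) := by
  obtain ⟨p, hp, hp'⟩ := hP
  obtain ⟨q, hq, hq'⟩ := hQ
  exact ⟨p + q, fun i => (hp i).add (hq i), fun x i => by simp [hp', hq']⟩

theorem isHomogeneousPolynomialMap_zero (d : ℕ) :
    IsHomogeneousPolynomialMap d (0 : (Fin n → ℂ) → (Fin n → ℂ)) :=
  ⟨0, fun _ => MvPolynomial.isHomogeneous_zero _ _ _, fun x i => by simp⟩

theorem SubResonance.IsPolynomialMap.sum {ι : Type*} {s : Finset ι} {P : ι → (Fin n → ℂ) → (Fin n → ℂ)}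
    (h : ∀ i ∈ s, IsPolynomialMap (P i)) : IsPolynomialMap fun x => ∑ i ∈ s, P i x := by
  classical
  choose! p hp using h
  refine ⟨fun k => ∑ i ∈ s, p i k, fun x k => ?_⟩
  change (∑ i ∈ s, P i x) k = MvPolynomial.eval x (∑ i ∈ s, p i k)
  rw [Finset.sum_apply, map_sum]
  exact Finset.sum_congr rfl fun i hi => hp i hi x k

theorem SubResonance.IsPolynomialMap.differentiable {P : (Fin n → ℂ) → (Fin n → ℂ)} (h : IsPolynomialMap P) :
    Differentiable ℂ P := by
  obtain ⟨p, hp⟩ := h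
  rw [differentiable_pi]
  intro i
  simp_rw [hp]
  induction p i using MvPolynomial.induction_on with
  | C a => simp
  | add p q hp hq => simpa using hp.fun_add hq
  | mul_X p j hp => simpa using hp.fun_mul (differentiable_apply j)

variable (L : (Fin n → ℂ) →L[ℂ] (Fin n → ℂ))

/-- A map into the generalized eigenspace of `μ` which is homogeneous of type `s`, with the degree
made explicit. -/
structure IsTypedTerm (μ : Eigenvalues L.toLinearMap) (s : Eigenvalues L.toLinearMap → ℕ)
    (Q : (Fin n → ℂ) → (Fin n → ℂ)) : Prop where
  homogeneous : IsHomogeneousPolynomialMap (∑ κ, s κ) Q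
  map_zero : Q 0 = 0
  scaling : ∀ (a : Eigenvalues L.toLinearMap → ℂ) (t : Eigenvalues L.toLinearMap → (Fin n → ℂ)),
    (∀ κ : Eigenvalues L.toLinearMap, t κ ∈ maxGenEigenspace L.toLinearMap (κ : ℂ)) →
      Q (∑ κ, a κ • t κ) = (∏ κ, a κ ^ s κ) • Q (∑ κ, t κ)
  mem : ∀ x, Q x ∈ maxGenEigenspace L.toLinearMap (μ : ℂ)

variable {L}

theorem IsTypedTerm.zero (μ : Eigenvalues L.toLinearMap) (s : Eigenvalues L.toLinearMap → ℕ) :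
    IsTypedTerm L μ s 0 :=
  ⟨isHomogeneousPolynomialMap_zero _, rfl, by simp, fun x => zero_mem _⟩

/-- The explicit degree matters here: two terms of the same type have the same degree, so their sum
is again homogeneous. -/
theorem IsTypedTerm.add {μ : Eigenvalues L.toLinearMap} {s : Eigenvalues L.toLinearMap → ℕ}
    {Q Q' : (Fin n → ℂ) → (Fin n → ℂ)} (h : IsTypedTerm L μ s Q) (h' : IsTypedTerm L μ s Q') :
    IsTypedTerm L μ s (Q + Q') where
  homogeneous := h.homogeneous.add h'.homogeneous
  map_zero := by simp [h.map_zero, h'.map_zero]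
  scaling a t ht := by simp [h.scaling a t ht, h'.scaling a t ht]
  mem x := add_mem (h.mem x) (h'.mem x)

variable (L)

/-- A finite family of sub-resonant terms, indexed by value space and type, summing to `P`. -/
def IsSubResonantSum (P : (Fin n → ℂ) → (Fin n → ℂ)) : Prop :=
  ∃ (T : Finset (Eigenvalues L.toLinearMap → ℕ))
    (Q : Eigenvalues L.toLinearMap → (Eigenvalues L.toLinearMap → ℕ) →
      (Fin n → ℂ) → (Fin n → ℂ)),
    (∀ μ s, IsTypedTerm L μ s (Q μ s)) ∧
    (∀ μ s, s ∉ T ∨ ¬ SubResonanceRelation L.toLinearMap μ s → Q μ s = 0) ∧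
    ∀ x, P x = ∑ μ, ∑ s ∈ T, Q μ s x

variable {L}

theorem IsSubResonantSum.zero : IsSubResonantSum L (0 : (Fin n → ℂ) → (Fin n → ℂ)) :=
  ⟨∅, 0, fun μ s => IsTypedTerm.zero μ s, by simp, by simp⟩

theorem IsSubResonantSum.add {P P' : (Fin n → ℂ) → (Fin n → ℂ)} (h : IsSubResonantSum L P)
    (h' : IsSubResonantSum L P') : IsSubResonantSum L (P + P') := by
  classical
  obtain ⟨T, Q, h1, h2, h3⟩ := h
  obtain ⟨T', Q', h1', h2', h3'⟩ := h'
  refine ⟨T ∪ T', Q + Q', fun μ s => (h1 μ s).add (h1' μ s), fun μ s hs => ?_, fun x => ?_⟩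
  · simp only [Finset.mem_union] at hs
    have a1 := h2 μ s (by tauto)
    have a2 := h2' μ s (by tauto)
    simp [a1, a2]
  · rw [Pi.add_apply, h3, h3', ← Finset.sum_add_distrib]
    refine Finset.sum_congr rfl fun μ _ => ?_
    rw [Finset.sum_subset Finset.subset_union_left (s₂ := T ∪ T') fun s _ hs => by
        simp [h2 μ s (Or.inl hs)],
      Finset.sum_subset Finset.subset_union_right (s₂ := T ∪ T') fun s _ hs => by
        simp [h2' μ s (Or.inl hs)], ← Finset.sum_add_distrib]
    rfl

theorem IsSubResonantSum.sum {ι : Type*} {S : Finset ι} {P : ι → (Fin n → ℂ) → (Fin n → ℂ)}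
    (h : ∀ i ∈ S, IsSubResonantSum L (P i)) : IsSubResonantSum L (∑ i ∈ S, P i) :=
  Finset.sum_induction P _ (fun _ _ => IsSubResonantSum.add) IsSubResonantSum.zero h

theorem IsSubResonantSum.of_term {μ : Eigenvalues L.toLinearMap}
    {s : Eigenvalues L.toLinearMap → ℕ} {Q : (Fin n → ℂ) → (Fin n → ℂ)}
    (h : IsTypedTerm L μ s Q) (hs : SubResonanceRelation L.toLinearMap μ s) :
    IsSubResonantSum L Q := by
  classical
  refine ⟨{s}, fun κ t => if κ = μ ∧ t = s then Q else 0, fun κ t => ?_, fun κ t ht => ?_,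
    fun x => ?_⟩
  · dsimp only
    split_ifs with hc
    · rw [hc.1, hc.2]
      exact h
    · exact IsTypedTerm.zero κ t
  · refine if_neg ?_
    rintro ⟨rfl, rfl⟩
    simp [hs] at ht
  · rw [Finset.sum_eq_single μ]
    · simp
    · intro κ _ hκ
      simp [hκ]
    · simp

theorem IsSubResonantSum.isSubResonant {P : (Fin n → ℂ) → (Fin n → ℂ)}
    (h : IsSubResonantSum L P) : IsSubResonant L.toLinearMap P := by
  classical
  obtain ⟨T, Q, h1, h2, h3⟩ := h
  refine ⟨?_, ?_, fun μ x => ∑ s ∈ T, Q μ s x, fun μ => ?_, h3⟩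
  · have : P = fun x => ∑ μ, ∑ s ∈ T, Q μ s x := funext h3
    rw [this]
    refine IsPolynomialMap.sum fun μ _ => IsPolynomialMap.sum fun s _ => ?_
    obtain ⟨q, -, hq⟩ := (h1 μ s).homogeneous
    exact ⟨q, hq⟩
  · rw [h3]
    simp [(h1 _ _).map_zero]
  · refine ⟨T.filter (SubResonanceRelation L.toLinearMap μ), Q μ, fun s hs => ?_, fun x => ?_⟩
    · exact ⟨(Finset.mem_filter.1 hs).2,
        ⟨⟨_, (h1 μ s).homogeneous⟩, (h1 μ s).map_zero, (h1 μ s).scaling⟩, (h1 μ s).mem⟩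
    · refine (Finset.sum_subset (Finset.filter_subset _ _) fun s hs hs' => ?_).symm
      rw [h2 μ s (Or.inr fun hc => hs' (Finset.mem_filter.2 ⟨hs, hc⟩))]
      rfl

namespace IsSpectralProjection

variable {π : Eigenvalues L.toLinearMap → (Fin n → ℂ) →L[ℂ] (Fin n → ℂ)}

/-- The type counts how often each eigenvalue occurs among the `ν j`, and the sub-resonance relation
is the logarithm of `hle`. -/
theorem isSubResonantSum_term (h : IsSpectralProjection L π)
    (h0 : ∀ κ : Eigenvalues L.toLinearMap, (κ : ℂ) ≠ 0) {d : ℕ} (hd : d ≠ 0)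
    (M : ContinuousMultilinearMap ℂ (fun _ : Fin d => (Fin n → ℂ)) (Fin n → ℂ))
    (μ : Eigenvalues L.toLinearMap) (ν : Fin d → Eigenvalues L.toLinearMap)
    (hle : ‖(μ : ℂ)‖ ≤ ∏ j, ‖(ν j : ℂ)‖) :
    IsSubResonantSum L fun z => π μ (M fun j => π (ν j) z) := by
  classical
  let s : Eigenvalues L.toLinearMap → ℕ := fun κ => (Finset.univ.filter fun j => ν j = κ).card
  have hs : ∑ κ, s κ = d := by
    simpa using (Finset.card_eq_sum_card_fiberwise (s := Finset.univ) (t := Finset.univ)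
      (f := ν) (by simp)).symm
  have hdiag := isHomogeneousPolynomialMap_diag
    ((π μ).compContinuousMultilinearMap (M.compContinuousLinearMap fun j => π (ν j)))
  refine IsSubResonantSum.of_term (μ := μ) (s := s) ⟨?_, ?_, fun a t ht => ?_, fun x => h.mem μ _⟩ ?_
  · rw [hs]
    exact hdiag
  · have : NeZero d := ⟨hd⟩
    have : (fun j => π (ν j) 0) = (0 : Fin d → (Fin n → ℂ)) := by ext1; simp
    change π μ (M fun j => π (ν j) 0) = 0
    rw [this, M.map_zero, map_zero]
  · have h1 : ∀ j, π (ν j) (∑ κ, a κ • t κ) = a (ν j) • t (ν j) := fun j =>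
      h.apply_sum (fun κ => Submodule.smul_mem _ _ (ht κ)) (ν j)
    have h2 : ∀ j, π (ν j) (∑ κ, t κ) = t (ν j) := fun j => h.apply_sum ht (ν j)
    have h3 : ∏ j, a (ν j) = ∏ κ, a κ ^ s κ := by
      rw [← Finset.prod_fiberwise' Finset.univ ν a]
      simp [s]
    simp only [h1, h2]
    have := M.map_smul_univ (fun j => a (ν j)) fun j => t (ν j)
    rw [this, map_smul, h3]
  · have h1 : ∑ j, Real.log ‖(ν j : ℂ)‖ = ∑ κ, (s κ : ℝ) * Real.log ‖(κ : ℂ)‖ := by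
      rw [← Finset.sum_fiberwise' Finset.univ ν fun κ => Real.log ‖(κ : ℂ)‖]
      simp [s]
    rw [SubResonanceRelation, ← h1, ← Real.log_prod fun j _ => norm_ne_zero_iff.2 (h0 _)]
    exact Real.log_le_log (norm_pos_iff.2 (h0 μ)) hle

theorem isSubResonantSum_linear (h : IsSpectralProjection L π)
    (h0 : ∀ κ : Eigenvalues L.toLinearMap, (κ : ℂ) ≠ 0) : IsSubResonantSum L L := by
  have h1 : ((L : (Fin n → ℂ) → (Fin n → ℂ))) = ∑ μ : Eigenvalues L.toLinearMap, fun z => π μ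
      (ContinuousMultilinearMap.ofSubsingleton ℂ (Fin n → ℂ) (Fin n → ℂ) (0 : Fin 1) L
        fun _ => π μ z) := by
    ext1 z
    rw [Finset.sum_apply]
    conv_lhs => rw [← h.sum (L z)]
    refine Finset.sum_congr rfl fun μ _ => ?_
    rw [ContinuousMultilinearMap.ofSubsingleton_apply_apply, h.comm, h.comm, h.idem]
  rw [h1]
  exact IsSubResonantSum.sum fun μ _ =>
    h.isSubResonantSum_term h0 one_ne_zero _ μ (fun _ => μ) (by simp)

end IsSpectralProjection

end Types

/-! ### Conjugacy to finite order. -/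

section Jets

open Filter Asymptotics Metric Module.End SubResonance

theorem isBigO_sq_sub_linear {E F : Type*} [NormedAddCommGroup E] [NormedSpace ℂ E]
    [NormedAddCommGroup F] [NormedSpace ℂ F] {G : E → F} {A : E →L[ℂ] F}
    (hG : ∀ᶠ z in 𝓝 0, DifferentiableAt ℂ G z) (hA : HasFDerivAt G A 0) (h0 : G 0 = 0) :
    (fun z => G z - A z) =O[𝓝 0] fun z => ‖z‖ ^ 2 := by
  obtain ⟨R, hR, M, hM, hd, hb⟩ := exists_ball_differentiableOn_bounded hG
  refine IsBigO.of_bound (4 * M / R ^ 2) ?_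
  filter_upwards [ball_mem_nhds (0 : E) hR] with z hz
  have := norm_sub_sub_fderiv_le hR hd hb (mem_ball_zero_iff.1 hz)
  rw [hA.fderiv, h0, zero_add, sub_zero] at this
  rw [norm_pow, norm_norm]
  refine this.trans_eq ?_
  field_simp

/-- The derivative of `G` differs from `A` by `O(‖x‖)`; the mean value inequality on the ball of
radius `‖u z‖ + ‖w z‖` gains one order over `w`. -/
theorem isBigO_comp_add_sub {E F X : Type*} [NormedAddCommGroup E] [NormedSpace ℂ E]
    [FiniteDimensional ℂ E] [NormedAddCommGroup F] [NormedSpace ℂ F] [CompleteSpace F]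
    [NormedAddCommGroup X] {G : E → F} {A : E →L[ℂ] F}
    (hG : ∀ᶠ z in 𝓝 0, DifferentiableAt ℂ G z) (hA : HasFDerivAt G A 0) {u w : X → E} {d : ℕ}
    (hd : d ≠ 0) (hu : u =O[𝓝 0] fun z => ‖z‖) (hw : w =O[𝓝 0] fun z => ‖z‖ ^ d) :
    (fun z => G (u z + w z) - G (u z) - A (w z)) =O[𝓝 0] fun z => ‖z‖ ^ (d + 1) := by
  have hF := (eventually_differentiableAt_fderiv hG).self_of_nhds.isBigO_sub
  rw [hA.fderiv] at hF
  obtain ⟨C, hC, hb⟩ := hF.exists_pos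
  obtain ⟨R, hR, h⟩ := Metric.eventually_nhds_iff_ball.1 (hG.and hb.bound)
  have hnorm : Tendsto (fun z : X => ‖z‖) (𝓝 0) (𝓝 0) := by
    simpa using (continuous_norm (E := X)).tendsto 0
  have hw1 : w =O[𝓝 0] fun z => ‖z‖ := by
    refine hw.trans (IsBigO.of_bound 1 ?_)
    filter_upwards [hnorm.eventually_lt_const one_pos] with z hz
    rw [norm_pow, norm_norm, one_mul]
    exact pow_le_of_le_one (norm_nonneg _) hz.le hd
  have hu0 := hu.trans_tendsto hnorm
  have hw0 := hw1.trans_tendsto hnorm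
  have hsmall : ∀ᶠ z in 𝓝 0, ‖u z‖ + ‖w z‖ < R := by
    have := (hu0.norm.add hw0.norm)
    rw [norm_zero, add_zero] at this
    exact this.eventually_lt_const hR
  have key : (fun z => G (u z + w z) - G (u z) - A (w z)) =O[𝓝 0]
      fun z => (‖u z‖ + ‖w z‖) * ‖w z‖ := by
    refine IsBigO.of_bound C ?_
    filter_upwards [hsmall] with z hz
    have hmem : ∀ x ∈ closedBall (0 : E) (‖u z‖ + ‖w z‖), x ∈ ball (0 : E) R := fun x hx =>
      mem_ball_zero_iff.2 ((mem_closedBall_zero_iff.1 hx).trans_lt hz)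
    let _ : NormedSpace ℝ E := NormedSpace.restrictScalars ℝ ℂ E
    have := (convex_closedBall (0 : E) (‖u z‖ + ‖w z‖)).norm_image_sub_le_of_norm_fderiv_le'
      (𝕜 := ℂ) (f := G) (φ := A) (C := C * (‖u z‖ + ‖w z‖)) (x := u z) (y := u z + w z)
      (fun x hx => (h x (hmem x hx)).1) (fun x hx => ?_) ?_ ?_
    · rw [add_sub_cancel_left] at this
      rw [Real.norm_of_nonneg (by positivity), ← mul_assoc]
      exact this
    · refine (h x (hmem x hx)).2.trans ?_
      rw [sub_zero]
      gcongr
      exact mem_closedBall_zero_iff.1 hx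
    · rw [mem_closedBall_zero_iff]
      linarith [norm_nonneg (w z)]
    · rw [mem_closedBall_zero_iff]
      exact norm_add_le _ _
  refine key.trans ?_
  have h1 : (fun z => (‖u z‖ + ‖w z‖) * ‖w z‖) =O[𝓝 0] fun z : X => ‖z‖ * ‖z‖ ^ d :=
    (hu.norm_left.add hw1.norm_left).mul hw.norm_left
  simpa only [pow_succ'] using h1

theorem isBigO_diag_sub {E F : Type*} [NormedAddCommGroup E] [NormedSpace ℂ E]
    [NormedAddCommGroup F] [NormedSpace ℂ F] {d : ℕ} (hd : d ≠ 0)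
    (H : ContinuousMultilinearMap ℂ (fun _ : Fin d => E) F) {u v : E → E}
    (hu : u =O[𝓝 0] fun z => ‖z‖) (hv : v =O[𝓝 0] fun z => ‖z‖)
    (huv : (fun z => u z - v z) =O[𝓝 0] fun z => ‖z‖ ^ 2) :
    (fun z => (H fun _ => u z) - H fun _ => v z) =O[𝓝 0] fun z => ‖z‖ ^ (d + 1) := by
  have : Nonempty (Fin d) := ⟨⟨0, Nat.pos_of_ne_zero hd⟩⟩
  have key : (fun z => (H fun _ => u z) - H fun _ => v z) =O[𝓝 0]
      fun z => (‖u z‖ + ‖v z‖) ^ (d - 1) * ‖u z - v z‖ := by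
    refine IsBigO.of_bound (‖H‖ * d) (Eventually.of_forall fun z => ?_)
    have h1 := H.norm_image_sub_le (fun _ => u z) fun _ => v z
    have h2 : (fun _ : Fin d => u z) - (fun _ => v z) = fun _ => u z - v z := rfl
    rw [h2, pi_norm_const, pi_norm_const, pi_norm_const, Fintype.card_fin] at h1
    rw [Real.norm_of_nonneg (by positivity), ← mul_assoc]
    refine h1.trans ?_
    gcongr
    exact max_le_add_of_nonneg (norm_nonneg _) (norm_nonneg _)
  refine key.trans ?_
  have h1 := ((hu.norm_left.add hv.norm_left).pow (d - 1)).mul huv.norm_left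
  refine h1.congr_right fun z => ?_
  rw [← pow_add]
  congr 1
  omega

theorem isBigO_diag {E F : Type*} [NormedAddCommGroup E] [NormedSpace ℂ E]
    [NormedAddCommGroup F] [NormedSpace ℂ F] {d : ℕ}
    (H : ContinuousMultilinearMap ℂ (fun _ : Fin d => E) F) :
    (fun z => H fun _ => z) =O[𝓝 0] fun z => ‖z‖ ^ d :=
  IsBigO.of_bound ‖H‖ (Eventually.of_forall fun z => by
    simpa using H.le_opNorm fun _ => z)

theorem hasFDerivAt_zero_of_isBigO {E F : Type*} [NormedAddCommGroup E] [NormedSpace ℂ E]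
    [NormedAddCommGroup F] [NormedSpace ℂ F] {f : E → F} {d : ℕ} (hd : 2 ≤ d)
    (h : f =O[𝓝 0] fun z => ‖z‖ ^ d) : HasFDerivAt f (0 : E →L[ℂ] F) 0 := by
  have h' : f =O[𝓝 0] fun z => ‖z - 0‖ ^ d := by simpa using h
  exact h'.hasFDerivAt (by omega)

variable {n : ℕ} {L L' : (Fin n → ℂ) →L[ℂ] (Fin n → ℂ)}

/-- The conjugacy equation can be solved to any finite order. -/
theorem exists_jet_conjugacy {F : (Fin n → ℂ) → (Fin n → ℂ)}
    (hF : ∀ᶠ z in 𝓝 0, DifferentiableAt ℂ F z) (hF0 : F 0 = 0) (hFL : HasFDerivAt F L 0)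
    (hL : ∀ x, L (L' x) = x) (hL' : ∀ x, L' (L x) = x) (d : ℕ) (hd : 2 ≤ d) :
    ∃ φ P : (Fin n → ℂ) → (Fin n → ℂ), IsSubResonantSum L P ∧ HasFDerivAt P L 0 ∧
      Differentiable ℂ φ ∧ φ 0 = 0 ∧ HasFDerivAt φ (ContinuousLinearMap.id ℂ (Fin n → ℂ)) 0 ∧
      (fun z => F (φ z) - φ (P z)) =O[𝓝 0] fun z => ‖z‖ ^ d := by
  obtain ⟨π, hπ⟩ := exists_isSpectralProjection L
  have hne := fun κ => eigenvalue_ne_zero hL' κ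
  induction d, hd using Nat.le_induction with
  | base =>
    exact ⟨id, L, hπ.isSubResonantSum_linear hne, L.hasFDerivAt, differentiable_id, rfl,
      hasFDerivAt_id 0, isBigO_sq_sub_linear hF hFL hF0⟩
  | succ d hd ih =>
    obtain ⟨φ, P, hP, hPL, hφ, hφ0, hφ1, hO⟩ := ih
    have hP0 : P 0 = 0 := hP.isSubResonant.2.1
    have hPd : Differentiable ℂ P := hP.isSubResonant.1.differentiable
    have hd0 : d ≠ 0 := by omega
    have hr : ∀ᶠ z in 𝓝 0, DifferentiableAt ℂ (fun z => F (φ z) - φ (P z)) z := by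
      have h1 : Tendsto φ (𝓝 0) (𝓝 0) := by simpa [hφ0] using hφ.continuous.tendsto 0
      filter_upwards [h1.eventually hF] with z hz
      exact (hz.comp z (hφ z)).sub ((hφ (P z)).comp z (hPd z))
    obtain ⟨M, hM⟩ := exists_multilinear_isBigO d hr hO
    obtain ⟨H, hH⟩ := hπ.exists_subresonant_reduction hL hL' M
    classical
    set S : (Fin n → ℂ) → (Fin n → ℂ) := fun z =>
      (M fun _ => z) + (L (H fun _ => z) - H fun _ => L z) with hSdef
    have hS : IsSubResonantSum L S := by
      have : S = ∑ p : Eigenvalues L.toLinearMap × (Fin d → Eigenvalues L.toLinearMap)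
          with ‖(p.1 : ℂ)‖ ≤ ∏ j, ‖(p.2 j : ℂ)‖, fun z => π p.1 (M fun j => π (p.2 j) z) := by
        ext1 z
        rw [Finset.sum_apply, hSdef]
        convert hH z
      rw [this]
      exact IsSubResonantSum.sum fun p hp =>
        hπ.isSubResonantSum_term hne hd0 M p.1 p.2 (Finset.mem_filter.1 hp).2
    have hLO : (fun z => L z) =O[𝓝 0] fun z => ‖z‖ := L.isBigO_id _ |>.norm_right
    have hHO := isBigO_diag H
    have hSO : S =O[𝓝 0] fun z => ‖z‖ ^ d := by
      refine (isBigO_diag M).add (((L.isBigO_comp _ _).trans hHO).sub ?_)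
      exact isBigO_diag (H.compContinuousLinearMap fun _ => L)
    have hφO : φ =O[𝓝 0] fun z => ‖z‖ := by
      simpa [hφ0] using hφ1.isBigO_sub.norm_right
    have hPO : P =O[𝓝 0] fun z => ‖z‖ := by
      simpa [hP0] using hPL.isBigO_sub.norm_right
    have hS0 : S 0 = 0 := hS.isSubResonant.2.1
    have hSL : HasFDerivAt S (0 : (Fin n → ℂ) →L[ℂ] (Fin n → ℂ)) 0 :=
      hasFDerivAt_zero_of_isBigO hd hSO
    have hPSL : HasFDerivAt (P + S) L 0 := by simpa using hPL.add hSL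
    have hPS := hP.add hS
    have hPS2 : (fun z => (P + S) z - L z) =O[𝓝 0] fun z => ‖z‖ ^ 2 :=
      isBigO_sq_sub_linear (Eventually.of_forall hPS.isSubResonant.1.differentiable) hPSL
        hPS.isSubResonant.2.1
    have hPSO : (P + S) =O[𝓝 0] fun z => ‖z‖ := by
      simpa [hP0, hS0] using hPSL.isBigO_sub.norm_right
    have hHL : HasFDerivAt (fun z => H fun _ => z) (0 : (Fin n → ℂ) →L[ℂ] (Fin n → ℂ)) 0 :=
      hasFDerivAt_zero_of_isBigO hd hHO
    have hHd : Differentiable ℂ fun z => H fun _ => z := by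
      have := (isHomogeneousPolynomialMap_diag H)
      obtain ⟨q, -, hq⟩ := this
      exact SubResonance.IsPolynomialMap.differentiable ⟨q, hq⟩
    refine ⟨fun z => φ z + H fun _ => z, P + S, hPS, hPSL, hφ.fun_add hHd, ?_, ?_, ?_⟩
    · have : NeZero d := ⟨hd0⟩
      have h0 : (fun _ => 0 : Fin d → (Fin n → ℂ)) = 0 := rfl
      change φ 0 + (H fun _ => 0) = 0
      rw [hφ0, h0, H.map_zero, add_zero]
    · simpa using hφ1.fun_add hHL
    · have e1 := isBigO_comp_add_sub hF hFL hd0 hφO hHO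
      have e2 := isBigO_comp_add_sub (Eventually.of_forall hφ) hφ1 hd0 hPO hSO
      have e3 := isBigO_diag_sub hd0 H hPSO hLO hPS2
      -- All terms of degree `d` cancel because `S = M + L ∘ H - H ∘ L`.
      refine (((e1.sub e2).sub e3).add hM).congr_left fun z => ?_
      simp only [hSdef, Pi.add_apply, ContinuousLinearMap.coe_id', id_eq]
      abel

end Jets

/-! ### Adapted norms and the contraction argument. -/

section FixedPoint

open Filter Asymptotics Metric Module.End

variable {E : Type*} [NormedAddCommGroup E] [NormedSpace ℂ E]

/-- `N` is a norm-like function equivalent to the norm, contracted by the factor `ρ` under `L`. -/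
structure IsAdaptedNorm (L : E →L[ℂ] E) (ρ C : ℝ) (N : E → ℝ) : Prop where
  continuous : Continuous N
  norm_le : ∀ z, ‖z‖ ≤ N z
  le_norm : ∀ z, N z ≤ C * ‖z‖
  add_le : ∀ x y, N (x + y) ≤ N x + N y
  map_le : ∀ z, N (L z) ≤ ρ * N z

/-- Choose `m` with `‖L ^ m‖ ≤ ρ ^ m` and sum `ρ⁻ᵏ ‖Lᵏ z‖` over `k < m`. Applying `L` shifts the
sum, and the new last term is at most the discarded first one. -/
theorem exists_isAdaptedNorm {L : E →L[ℂ] E} {C ρ₀ ρ : ℝ} (hρ₀ : 0 ≤ ρ₀) (hρ : ρ₀ < ρ)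
    (hL : ∀ k : ℕ, ‖L ^ k‖ ≤ C * ρ₀ ^ k) : ∃ D > 0, ∃ N, IsAdaptedNorm L ρ D N := by
  have hρ0 : 0 < ρ := hρ₀.trans_lt hρ
  obtain ⟨m, hm, hm0⟩ : ∃ m : ℕ, ‖L ^ m‖ ≤ ρ ^ m ∧ 0 < m := by
    have h1 : Tendsto (fun k : ℕ => C * (ρ₀ / ρ) ^ k) atTop (𝓝 (C * 0)) :=
      (tendsto_pow_atTop_nhds_zero_of_lt_one (by positivity) ((div_lt_one hρ0).2 hρ)).const_mul C
    rw [mul_zero] at h1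
    obtain ⟨m, hm, hm0⟩ := ((h1.eventually_lt_const one_pos).and (eventually_gt_atTop 0)).exists
    refine ⟨m, (hL m).trans ?_, hm0⟩
    rw [div_pow, ← mul_div_assoc, div_lt_one (by positivity)] at hm
    exact hm.le
  refine ⟨∑ k ∈ Finset.range m, ρ⁻¹ ^ k * ‖L ^ k‖ + 1, by positivity,
    fun z => ∑ k ∈ Finset.range m, ρ⁻¹ ^ k * ‖(L ^ k) z‖, ?_, fun z => ?_, fun z => ?_,
    fun x y => ?_, fun z => ?_⟩
  · fun_prop
  · have := Finset.single_le_sum (f := fun k => ρ⁻¹ ^ k * ‖(L ^ k) z‖)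
      (fun k _ => by positivity) (Finset.mem_range.2 hm0)
    simpa using this
  · rw [add_mul, Finset.sum_mul, one_mul]
    refine le_add_of_le_of_nonneg (Finset.sum_le_sum fun k _ => ?_) (norm_nonneg z)
    rw [mul_assoc]
    gcongr
    exact (L ^ k).le_opNorm z
  · rw [← Finset.sum_add_distrib]
    refine Finset.sum_le_sum fun k _ => ?_
    rw [← mul_add, map_add]
    gcongr
    exact norm_add_le _ _
  · have h1 : ∀ k, ρ⁻¹ ^ k * ‖(L ^ k) (L z)‖ = ρ * (ρ⁻¹ ^ (k + 1) * ‖(L ^ (k + 1)) z‖) := fun k => by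
      rw [pow_succ L, mul_apply_eq_comp, pow_succ]
      field_simp
    simp_rw [h1, ← Finset.mul_sum]
    refine mul_le_mul_of_nonneg_left ?_ hρ0.le
    have h2 := Finset.sum_range_succ' (fun k => ρ⁻¹ ^ k * ‖(L ^ k) z‖) m
    rw [Finset.sum_range_succ] at h2
    have h3 : ρ⁻¹ ^ m * ‖(L ^ m) z‖ ≤ ‖z‖ := by
      rw [inv_pow, inv_mul_le_iff₀ (by positivity)]
      exact ((L ^ m).le_opNorm z).trans (by gcongr)
    simp only [pow_zero, one_mul, one_apply_eq_self] at h2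
    linarith

/-- Conjugacies up to a sufficiently high order can be corrected to genuine conjugacies. -/
theorem exists_correction [FiniteDimensional ℂ E] {F φ P : E → E} {L L' : E →L[ℂ] E}
    {N : E → ℝ} {ρ ρ' D : ℝ} {K : ℕ} (hK : K ≠ 0)
    (hF : ∀ᶠ z in 𝓝 0, DifferentiableAt ℂ F z) (hFL : HasFDerivAt F L 0)
    (hL : ∀ x, L (L' x) = x) (hL' : ∀ x, L' (L x) = x)
    (hφ : Differentiable ℂ φ) (hφ0 : φ 0 = 0) (hP : Differentiable ℂ P) (hP0 : P 0 = 0)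
    (hPL : HasFDerivAt P L 0) (hN : IsAdaptedNorm L ρ D N) (hD : 0 < D) (hρ0 : 0 < ρ)
    (hρ : ρ < ρ') (hρ1 : ρ' < 1) (hq : ‖L'‖ * ρ' ^ K < 1)
    (hO : (fun z => F (φ z) - φ (P z)) =O[𝓝 0] fun z => ‖z‖ ^ K) :
    ∃ g : E → E, (∀ᶠ z in 𝓝 0, DifferentiableAt ℂ g z) ∧ (g =O[𝓝 0] fun z => ‖z‖ ^ K) ∧
      ∀ᶠ z in 𝓝 0, F (φ z + g z) = φ (P z) + g (P z) := by
  have : CompleteSpace E := FiniteDimensional.complete ℂ E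
  have hN0 : ∀ z, 0 ≤ N z := fun z => (norm_nonneg z).trans (hN.norm_le z)
  have hN00 : N 0 = 0 := le_antisymm (by simpa using hN.le_norm 0) (hN0 0)
  obtain ⟨η, hη, hqη⟩ : ∃ η : NNReal, 0 < η ∧ ‖L'‖ * ρ' ^ K + ‖L'‖ * η < 1 := by
    have hpos : 0 < (1 - ‖L'‖ * ρ' ^ K) / (‖L'‖ + 1) := div_pos (by linarith) (by positivity)
    refine ⟨⟨_, hpos.le⟩, hpos, ?_⟩
    change _ + ‖L'‖ * ((1 - ‖L'‖ * ρ' ^ K) / (‖L'‖ + 1)) < 1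
    have h1 : ‖L'‖ * ((1 - ‖L'‖ * ρ' ^ K) / (‖L'‖ + 1)) < 1 - ‖L'‖ * ρ' ^ K := by
      rw [← mul_div_assoc, div_lt_iff₀ (by positivity)]
      nlinarith [norm_nonneg L']
    linarith
  -- The contraction factor of `T` below: the first summand comes from `g ∘ P`, the second from the
  -- Lipschitz constant `η` of `F - L` near `0`.
  set q := ‖L'‖ * ρ' ^ K + ‖L'‖ * η with hqdef
  have hρ'0 : 0 < ρ' := hρ0.trans hρ
  have hq0 : 0 ≤ q := by positivity
  have hq1 : 0 < 1 - q := by linarith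
  have hstrict : HasStrictFDerivAt F L 0 := by
    have hc := (eventually_differentiableAt_fderiv hF).self_of_nhds.continuousAt
    have := hasStrictFDerivAt_of_hasFDerivAt_of_continuousAt
      (hF.mono fun z hz => hz.hasFDerivAt) hc
    rwa [hFL.fderiv] at this
  obtain ⟨s, hs, happ⟩ := hstrict.approximates_deriv_on_nhds (c := η) (Or.inr hη)
  obtain ⟨R, hR, hball⟩ := Metric.eventually_nhds_iff_ball.1 (hF.and (show ∀ᶠ z in 𝓝 0, z ∈ s from hs))
  obtain ⟨C₀, hC₀, hb⟩ := hO.exists_pos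
  set C₁ := ‖L'‖ * C₀ with hC₁
  have hC₁0 : 0 ≤ C₁ := by positivity
  -- The fixed point of `c ↦ q * c + C₁`, so that the bound `C₂ * N z ^ K` is preserved by `T`.
  set C₂ := C₁ / (1 - q) with hC₂
  have hC₂0 : 0 ≤ C₂ := by positivity
  have hsum : q * C₂ + C₁ = C₂ := by rw [hC₂]; field_simp; ring
  have c1 : ∀ᶠ z in 𝓝 0, N (P z) ≤ ρ' * N z := by
    have h1 := hPL.isLittleO.def (c := (ρ' - ρ) / D) (div_pos (by linarith) hD)
    filter_upwards [h1] with z hz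
    rw [hP0, sub_zero, sub_zero] at hz
    have h2 := hN.add_le (L z) (P z - L z)
    rw [add_sub_cancel] at h2
    have h3 := hN.le_norm (P z - L z)
    have h4 : D * ‖P z - L z‖ ≤ (ρ' - ρ) * ‖z‖ := by
      calc D * ‖P z - L z‖ ≤ D * ((ρ' - ρ) / D * ‖z‖) := by gcongr
        _ = _ := by field_simp
    have h5 : (ρ' - ρ) * ‖z‖ ≤ (ρ' - ρ) * N z :=
      mul_le_mul_of_nonneg_left (hN.norm_le z) (by linarith)
    linarith [hN.map_le z]
  have c3 : ∀ᶠ z in 𝓝 0, ‖φ z‖ + C₂ * N z ^ K < R := by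
    have hc : ContinuousAt (fun z => ‖φ z‖ + C₂ * N z ^ K) 0 :=
      (hφ.continuous.norm.add (continuous_const.mul (hN.continuous.pow K))).continuousAt
    exact hc.eventually_lt continuousAt_const (by simpa [hφ0, hN00, hK] using hR)
  obtain ⟨r, hr, hall⟩ := Metric.eventually_nhds_iff_ball.1 (c1.and (hb.bound.and c3))
  -- A sublevel set of `N` rather than a norm ball, since `P` contracts `N` and hence maps `B` into
  -- itself.
  set B : Set E := {z | N z < r} with hB
  have hBo : IsOpen B := isOpen_lt hN.continuous continuous_const
  have hB0 : (0 : E) ∈ B := by simpa [hB, hN00] using hr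
  have hBall : ∀ z ∈ B, z ∈ ball (0 : E) r := fun z hz =>
    mem_ball_zero_iff.2 ((hN.norm_le z).trans_lt hz)
  have hPN : ∀ z ∈ B, N (P z) ≤ ρ' * N z := fun z hz => (hall z (hBall z hz)).1
  have hPB : ∀ z ∈ B, P z ∈ B := fun z hz =>
    ((hPN z hz).trans (mul_le_of_le_one_left (hN0 z) hρ1.le)).trans_lt hz
  have herr : ∀ z ∈ B, ‖L' (φ (P z) - F (φ z))‖ ≤ C₁ * N z ^ K := fun z hz => by
    have h1 := (hall z (hBall z hz)).2.1
    rw [norm_pow, norm_norm, norm_sub_rev] at h1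
    calc _ ≤ ‖L'‖ * ‖φ (P z) - F (φ z)‖ := L'.le_opNorm _
      _ ≤ ‖L'‖ * (C₀ * ‖z‖ ^ K) := by gcongr
      _ ≤ ‖L'‖ * (C₀ * N z ^ K) := by gcongr; exact hN.norm_le z
      _ = _ := by rw [hC₁]; ring
  have hmem : ∀ z ∈ B, ∀ w : E, ‖w‖ ≤ C₂ * N z ^ K → φ z + w ∈ ball (0 : E) R :=
    fun z hz w hw => by
      rw [mem_ball_zero_iff]
      linarith [norm_add_le (φ z) w, (hall z (hBall z hz)).2.2]
  -- Write `F = L + (F - L)` in `F (φ + g) = φ ∘ P + g ∘ P` and solve for the `g` under `L`: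
  -- solutions are the fixed points of `T`.
  let T : (E → E) → E → E := fun g z =>
    L' (g (P z) + φ (P z) - (F (φ z + g z) - L (φ z + g z))) - φ z
  let Good : (E → E) → Prop := fun g =>
    DifferentiableOn ℂ g B ∧ ∀ z ∈ B, ‖g z‖ ≤ C₂ * N z ^ K
  have hT0 : ∀ z ∈ B, ‖T 0 z‖ ≤ C₁ * N z ^ K := fun z hz => by
    have h1 : T 0 z = L' (φ (P z) - F (φ z)) := by
      simp only [T, Pi.zero_apply, zero_add, add_zero, map_sub, hL']
      abel
    rw [h1]
    exact herr z hz
  have hTsub : ∀ g₁ g₂, Good g₁ → Good g₂ → ∀ c : ℝ, 0 ≤ c →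
      (∀ z ∈ B, ‖g₁ z - g₂ z‖ ≤ c * N z ^ K) →
      ∀ z ∈ B, ‖T g₁ z - T g₂ z‖ ≤ q * c * N z ^ K := by
    intro g₁ g₂ h₁ h₂ c hc0 hc z hz
    have e1 : T g₁ z - T g₂ z = L' ((g₁ (P z) - g₂ (P z)) -
        (F (φ z + g₁ z) - F (φ z + g₂ z) - L ((φ z + g₁ z) - (φ z + g₂ z)))) := by
      simp only [T, map_sub, map_add]
      abel
    have e2 := happ _ (hball _ (hmem z hz _ (h₁.2 z hz))).2 _
      (hball _ (hmem z hz _ (h₂.2 z hz))).2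
    rw [add_sub_add_left_eq_sub] at e2
    rw [e1, add_sub_add_left_eq_sub]
    have e3 := hc z hz
    have e4 := hc (P z) (hPB z hz)
    have hz0 := hN0 z
    calc _ ≤ ‖L'‖ * (‖g₁ (P z) - g₂ (P z)‖ +
          ‖F (φ z + g₁ z) - F (φ z + g₂ z) - L (g₁ z - g₂ z)‖) :=
          (L'.le_opNorm _).trans (by gcongr; exact norm_sub_le _ _)
      _ ≤ ‖L'‖ * (c * (ρ' * N z) ^ K + η * (c * N z ^ K)) := by
          gcongr
          · refine e4.trans ?_
            gcongr
            · exact hN0 _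
            · exact hPN z hz
          · exact e2.trans (by gcongr)
      _ = _ := by rw [hqdef, mul_pow]; ring
  have hG0 : Good 0 := ⟨differentiableOn_const 0, fun z _ => by
    have := hN0 z
    simp only [Pi.zero_apply, norm_zero]
    positivity⟩
  have hTG : ∀ g, Good g → Good (T g) := by
    intro g hg
    refine ⟨?_, fun z hz => ?_⟩
    · have hgP : DifferentiableOn ℂ (fun z => g (P z)) B :=
        hg.1.comp hP.differentiableOn hPB
      have hφg : DifferentiableOn ℂ (fun z => φ z + g z) B := hφ.differentiableOn.add hg.1
      have hFg : DifferentiableOn ℂ (fun z => F (φ z + g z)) B := fun z hz =>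
        (hball _ (hmem z hz _ (hg.2 z hz))).1.comp_differentiableWithinAt z (hφg z hz)
      have hφP : DifferentiableOn ℂ (fun z => φ (P z)) B := (hφ.comp hP).differentiableOn
      have hLφ : DifferentiableOn ℂ (fun z => L (φ z + g z)) B :=
        L.differentiable.comp_differentiableOn hφg
      exact (L'.differentiable.comp_differentiableOn
        ((hgP.fun_add hφP).fun_sub (hFg.fun_sub hLφ))).fun_sub hφ.differentiableOn
    · have h1 := hTsub g 0 hg hG0 C₂ hC₂0 (fun z hz => by simpa using hg.2 z hz) z hz
      have h2 := hT0 z hz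
      have h3 := norm_le_norm_sub_add (T g z) (T 0 z)
      calc ‖T g z‖ ≤ (q * C₂ + C₁) * N z ^ K := by linarith
        _ = _ := by rw [hsum]
  have hGk : ∀ k, Good (T^[k] 0) := fun k => by
    induction k with
    | zero => exact hG0
    | succ k ih => rw [Function.iterate_succ_apply']; exact hTG _ ih
  have hstep : ∀ k, ∀ z ∈ B, ‖T^[k + 1] 0 z - T^[k] 0 z‖ ≤ q ^ k * C₁ * N z ^ K := fun k => by
    induction k with
    | zero => intro z hz; simpa using hT0 z hz
    | succ k ih =>
      intro z hz
      have := hTsub _ _ (hGk (k + 1)) (hGk k) (q ^ k * C₁) (by positivity) ih z hz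
      rw [← Function.iterate_succ_apply' T, ← Function.iterate_succ_apply' T] at this
      refine this.trans_eq ?_
      ring
  have hdist : ∀ z ∈ B, ∀ k, dist (T^[k] 0 z) (T^[k + 1] 0 z) ≤ C₁ * N z ^ K * q ^ k :=
    fun z hz k => by
      rw [dist_comm, dist_eq_norm]
      exact (hstep k z hz).trans_eq (by ring)
  have hlim : ∀ z ∈ B, ∃ y, Tendsto (fun k => T^[k] 0 z) atTop (𝓝 y) := fun z hz =>
    cauchySeq_tendsto_of_complete
      (cauchySeq_of_le_geometric q _ (by linarith) (hdist z hz))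
  choose! g hg using hlim
  have hgbound : ∀ z ∈ B, ‖g z‖ ≤ C₂ * N z ^ K := fun z hz =>
    le_of_tendsto (hg z hz).norm (Eventually.of_forall fun k => (hGk k).2 z hz)
  have hunif : TendstoUniformlyOn (fun k => T^[k] 0) g atTop B := by
    rw [Metric.tendstoUniformlyOn_iff]
    intro ε hε
    have h1 : Tendsto (fun k : ℕ => C₁ * r ^ K * q ^ k / (1 - q)) atTop
        (𝓝 (C₁ * r ^ K * 0 / (1 - q))) :=
      ((tendsto_pow_atTop_nhds_zero_of_lt_one hq0 (by linarith)).const_mul _).div_const _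
    rw [mul_zero, zero_div] at h1
    filter_upwards [h1.eventually_lt_const hε] with k hk z hz
    rw [dist_comm]
    refine (dist_le_of_le_geometric_of_tendsto q _ (by linarith) (hdist z hz) (hg z hz) k).trans_lt
      (lt_of_le_of_lt ?_ hk)
    have hz' : N z ≤ r := le_of_lt hz
    have := hN0 z
    gcongr
  have hgd : DifferentiableOn ℂ g B :=
    differentiableOn_of_tendstoUniformlyOn hBo (Eventually.of_forall fun k => (hGk k).1) hunif
  have hfix : ∀ z ∈ B, T g z = g z := fun z hz => by
    have h1 : Tendsto (fun k => T (T^[k] 0) z) atTop (𝓝 (T g z)) := by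
      have hFc : ContinuousAt F (φ z + g z) :=
        (hball _ (hmem z hz _ (hgbound z hz))).1.continuousAt
      have h2 : Tendsto (fun k => φ z + T^[k] 0 z) atTop (𝓝 (φ z + g z)) :=
        (hg z hz).const_add _
      exact ((L'.continuous.tendsto _).comp ((((hg _ (hPB z hz)).add_const _).sub
        ((hFc.tendsto.comp h2).sub ((L.continuous.tendsto _).comp h2))))).sub_const _
    simp_rw [← Function.iterate_succ_apply' T] at h1
    exact tendsto_nhds_unique h1 ((tendsto_add_atTop_iff_nat 1).2 (hg z hz))
  have hBn : B ∈ 𝓝 (0 : E) := hBo.mem_nhds hB0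
  refine ⟨g, ?_, IsBigO.of_bound (C₂ * D ^ K) ?_, ?_⟩
  · filter_upwards [hBn] with z hz using hgd.differentiableAt (hBo.mem_nhds hz)
  · filter_upwards [hBn] with z hz
    rw [norm_pow, norm_norm, mul_assoc, ← mul_pow]
    refine (hgbound z hz).trans ?_
    have := hN0 z
    gcongr
    exact hN.le_norm z
  · filter_upwards [hBn] with z hz
    have h1 : L' (g (P z) + φ (P z) - (F (φ z + g z) - L (φ z + g z))) = φ z + g z := by
      rw [← sub_eq_iff_eq_add']
      exact hfix z hz
    have h2 := congrArg L h1
    rw [hL, sub_sub_eq_add_sub, sub_eq_iff_eq_add, add_comm (L _), add_left_inj] at h2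
    rw [← h2, add_comm]

end FixedPoint

/-! ### Local inversion and a uniform bound on eigenvalues. -/

section LocalInverse

open Filter SubResonance

variable {n : ℕ}

theorem exists_local_biholomorphism {ψ : (Fin n → ℂ) → (Fin n → ℂ)}
    (hψ : ∀ᶠ z in 𝓝 0, DifferentiableAt ℂ ψ z)
    (hψ1 : HasFDerivAt ψ (ContinuousLinearMap.id ℂ (Fin n → ℂ)) 0) :
    ∃ φ : OpenPartialHomeomorph (Fin n → ℂ) (Fin n → ℂ), IsLocalBiholomorphism φ ∧
      (0 : Fin n → ℂ) ∈ φ.source ∧ ⇑φ = ψ := by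
  have hc := (eventually_differentiableAt_fderiv hψ).self_of_nhds.continuousAt
  have hstrict : HasStrictFDerivAt ψ
      ((ContinuousLinearEquiv.refl ℂ (Fin n → ℂ) : (Fin n → ℂ) →L[ℂ] (Fin n → ℂ))) 0 := by
    have := hasStrictFDerivAt_of_hasFDerivAt_of_continuousAt
      (hψ.mono fun z hz => hz.hasFDerivAt) hc
    rwa [hψ1.fderiv] at this
  have hinv : ∀ᶠ z in 𝓝 0, ∃ A : (Fin n → ℂ) ≃L[ℂ] (Fin n → ℂ),
      (A : (Fin n → ℂ) →L[ℂ] (Fin n → ℂ)) = fderiv ℂ ψ z := by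
    have h1 := ContinuousLinearEquiv.nhds (ContinuousLinearEquiv.refl ℂ (Fin n → ℂ))
    have h2 : fderiv ℂ ψ 0 = (ContinuousLinearEquiv.refl ℂ (Fin n → ℂ) :
        (Fin n → ℂ) →L[ℂ] (Fin n → ℂ)) := hψ1.fderiv
    rw [← h2] at h1
    exact hc.eventually_mem h1
  -- Restricting to `V` keeps the derivative invertible throughout the source, so the inverse is
  -- holomorphic on the whole target and not only at `0`.
  obtain ⟨V, hV, hVo, h0V⟩ := eventually_nhds_iff.1 (hψ.and hinv)
  let φ := (hstrict.toOpenPartialHomeomorph ψ).restrOpen V hVo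
  have hφ : ⇑φ = ψ := rfl
  have hsrc : ∀ z ∈ φ.source, z ∈ V := fun z hz => hz.2
  refine ⟨φ, ⟨?_, ?_⟩, ⟨hstrict.mem_toOpenPartialHomeomorph_source, h0V⟩, hφ⟩
  · intro z hz
    exact (hV z (hsrc z hz)).1.differentiableWithinAt
  · intro w hw
    obtain ⟨hd, A, hA⟩ := hV _ (hsrc _ (φ.map_target hw))
    have h1 : HasFDerivAt φ (A : (Fin n → ℂ) →L[ℂ] (Fin n → ℂ)) (φ.symm w) := by
      rw [hA, hφ]
      exact hd.hasFDerivAt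
    exact (φ.hasFDerivAt_symm hw h1).differentiableAt.differentiableWithinAt

theorem exists_contraction_rate {L : Module.End ℂ (Fin n → ℂ)} (h : IsContracting L) :
    ∃ r : ℝ, 0 ≤ r ∧ r < 1 ∧ ∀ μ : ℂ, L.HasEigenvalue μ → ‖μ‖ ≤ r := by
  -- Taken in `NNReal`, where an empty supremum is `0`; this covers `n = 0`.
  refine ⟨((Finset.univ.sup fun μ : L.Eigenvalues => ‖(μ : ℂ)‖₊ : NNReal) : ℝ), NNReal.coe_nonneg _,
    ?_, fun μ hμ => ?_⟩
  · rw [← NNReal.coe_one, NNReal.coe_lt_coe, Finset.sup_lt_iff (by simp)]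
    intro μ _
    exact h μ μ.2
  · have := Finset.le_sup (f := fun μ : L.Eigenvalues => ‖(μ : ℂ)‖₊) (Finset.mem_univ ⟨μ, hμ⟩)
    exact_mod_cast this

end LocalInverse

/-! ### Assembly. -/

theorem theorem3p9 (n : ℕ) (U : Set (Fin n → ℂ)) (hU : IsOpen U) (h0U : (0 : Fin n → ℂ) ∈ U)
    (F : (Fin n → ℂ) → (Fin n → ℂ)) (hF : DifferentiableOn ℂ F U) (hF0 : F 0 = 0)
    (L : (Fin n → ℂ) →L[ℂ] (Fin n → ℂ)) (hFL : HasFDerivAt F L 0)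
    (hLinv : L.IsInvertible) (hLcontr : SubResonance.IsContracting L.toLinearMap) :
    ∃ P ∈ SubResonance.SRStar L.toLinearMap,
      HasFDerivAt P L 0 ∧
      ∃ φ : OpenPartialHomeomorph (Fin n → ℂ) (Fin n → ℂ),
        SubResonance.IsLocalBiholomorphism φ ∧
        (0 : Fin n → ℂ) ∈ φ.source ∧ φ 0 = 0 ∧
        HasFDerivAt φ (ContinuousLinearMap.id ℂ (Fin n → ℂ)) 0 ∧
        ∀ᶠ z in 𝓝 (0 : Fin n → ℂ),
          z ∈ φ.source ∧ φ z ∈ U ∧ F (φ z) ∈ φ.target ∧ φ.symm (F (φ z)) = P z := by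
  obtain ⟨e, rfl⟩ := hLinv
  set L : (Fin n → ℂ) →L[ℂ] (Fin n → ℂ) := (e : (Fin n → ℂ) →L[ℂ] (Fin n → ℂ)) with hLdef
  set L' : (Fin n → ℂ) →L[ℂ] (Fin n → ℂ) := (e.symm : (Fin n → ℂ) →L[ℂ] (Fin n → ℂ)) with hL'def
  have hL : ∀ x, L (L' x) = x := e.apply_symm_apply
  have hL' : ∀ x, L' (L x) = x := e.symm_apply_apply
  have hFd : ∀ᶠ z in 𝓝 0, DifferentiableAt ℂ F z := by
    filter_upwards [hU.mem_nhds h0U] with z hz using hF.differentiableAt (hU.mem_nhds hz)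
  obtain ⟨r, hr0, hr1, hr⟩ := exists_contraction_rate hLcontr
  -- Successive room below `1`: `ρ₀` for the powers of `L`, `ρ` for `L` in the adapted norm, `ρ'`
  -- for the nonlinear map `P`.
  obtain ⟨ρ₀, hrρ, hρ₀⟩ := exists_between hr1
  obtain ⟨ρ, hρ₀ρ, hρ⟩ := exists_between hρ₀
  obtain ⟨ρ', hρρ', hρ'⟩ := exists_between hρ
  obtain ⟨C, hC, hCb⟩ := exists_norm_pow_le_of_eigenvalues (B := L) hr0 hrρ hr
  obtain ⟨D, hD, N, hN⟩ := exists_isAdaptedNorm (hr0.trans hrρ.le) hρ₀ρ hCb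
  have hρ0 : 0 < ρ := hr0.trans_lt (hrρ.trans hρ₀ρ)
  -- `K` depends only on `L'` and `ρ'`, so it can be fixed before the jet conjugacy is chosen.
  obtain ⟨K, hK, hK2⟩ : ∃ K : ℕ, ‖L'‖ * ρ' ^ K < 1 ∧ 2 ≤ K := by
    have h1 := (tendsto_pow_atTop_nhds_zero_of_lt_one (hρ0.trans hρρ').le hρ').const_mul ‖L'‖
    rw [mul_zero] at h1
    exact ((h1.eventually_lt_const one_pos).and (Filter.eventually_ge_atTop 2)).exists
  obtain ⟨φ, P, hP, hPL, hφ, hφ0, hφ1, hO⟩ :=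
    exists_jet_conjugacy hFd hF0 hFL hL hL' K hK2
  have hPd : Differentiable ℂ P := hP.isSubResonant.1.differentiable
  have hP0 : P 0 = 0 := hP.isSubResonant.2.1
  obtain ⟨g, hg, hgO, hconj⟩ := exists_correction (by omega) hFd hFL hL hL' hφ hφ0 hPd hP0 hPL
    hN hD hρ0 hρρ' hρ' hK hO
  have hg0 : g 0 = 0 := by
    obtain ⟨c, hc⟩ := hgO.bound
    simpa [show K ≠ 0 by omega] using hc.self_of_nhds
  have hψ1 : HasFDerivAt (fun z => φ z + g z) (ContinuousLinearMap.id ℂ (Fin n → ℂ)) 0 := by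
    simpa using hφ1.fun_add (hasFDerivAt_zero_of_isBigO hK2 hgO)
  obtain ⟨ψ, hψ, hψ0, hψe⟩ := exists_local_biholomorphism
    (hg.mono fun z hz => (hφ z).fun_add hz) hψ1
  have hψz : ∀ z, ψ z = φ z + g z := fun z => congrFun hψe z
  have hψ00 : ψ 0 = 0 := by rw [hψz, hφ0, hg0, add_zero]
  refine ⟨P, ⟨hP.isSubResonant, ?_⟩, hPL, ψ, hψ, hψ0, hψ00, by rwa [hψe], ?_⟩
  · rw [hPL.fderiv]
    exact ⟨e, rfl⟩
  · have hsrc : ψ.source ∈ 𝓝 0 := ψ.open_source.mem_nhds hψ0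
    have hPt : Filter.Tendsto P (𝓝 0) (𝓝 0) := by simpa [hP0] using hPd.continuous.tendsto 0
    have hψt : Filter.Tendsto ψ (𝓝 0) (𝓝 0) := by
      simpa [hψ00] using (ψ.continuousAt hψ0).tendsto
    filter_upwards [hsrc, hPt.eventually_mem hsrc, hψt.eventually_mem (hU.mem_nhds h0U), hconj]
      with z h1 h2 h3 h4
    have h5 : F (ψ z) = ψ (P z) := by rw [hψz, hψz, h4]
    refine ⟨h1, h3, ?_, ?_⟩
    · rw [h5]
      exact ψ.map_source h2
    · rw [h5, ψ.left_inv h2]
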